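/- Notation. Let $\Delta\subset\mathbb{C}$ be the open unit disk and, for $\zeta,\eta\in\Delta$, let $\rho_\Delta(\zeta,\eta)=\tfrac12\log\frac{1+t}{1-t}$ with $t=\left|\frac{\zeta-\eta}{1-\bar\eta\zeta}\right|$ be the Poincaré distance. A domain in $\mathbb{C}^d$ is a non-empty connected open subset. For a bounded domain $\Omega\subset\mathbb{C}^d$ let $\mathrm{Hol}(\Delta,\Omega)$ be the set of holomorphic maps $\Delta\to\Omega$, let $\delta_\Omega(x)$ be the Euclidean distance from $x\in\Omega$ to $\partial\Omega$, let $$K_\Omega(x,y)=\inf\sum_{i=1}^n\rho_\Delta(\zeta_{i-1},\zeta_i)$$ be the Kobayashi distance, the infimum being over all $n\ge 1$, $\phi_1,\dots,\phi_n\in\mathrm{Hol}(\Delta,\Omega)$ and $\zeta_0,\dots,\zeta_n\in\Delta$ with $\phi_1(\zeta_0)=x$, $\phi_n(\zeta_n)=y$ and $\phi_i(\zeta_i)=\phi_{i+1}(\zeta_i)$ for $1\le i<n$, and let $$k_\Omega(x;v)=\inf\{|\xi| : \xi\in\mathbb{C},\ \phi\in\mathrm{Hol}(\Delta,\Omega),\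 \phi(0)=x,\ \xi\,\phi'(0)=v\}$$ be the Kobayashi–Royden metric. Put $M_\Omega(r)=\sup\{1/k_\Omega(x;v) : x\in\Omega,\ \delta_\Omega(x)\le r,\ \|v\|=1\}$. The bounded domain $\Omega$ is a *Goldilocks domain* if 1. $\int_0^\epsilon \frac1r M_\Omega(r)\,dr<\infty$ for some $\epsilon>0$, and 2. for each $x_0\in\Omega$ there are constants $C,\alpha>0$ such that $K_\Omega(x_0,x)\le C+\alpha\log\frac{1}{\delta_\Omega(x)}$ for all $x\in\Omega$. It is *taut* if every sequence in $\mathrm{Hol}(\Delta,\Omega)$ has a subsequence $(\phi_n)$ that either converges locally uniformly on $\Delta$ to an element of $\mathrm{Hol}(\Delta,\Omega)$, or is compactly divergent: for all compact $A\subset\Delta$ and $L\subset\Omega$, $\phi_n(A)\cap L=\emptyset$ for all sufficiently large $n$. **Theorem 1.4.** Let $\Omega\subset\mathbb{C}^d$ be a taut Goldilocks domain and $f:\Omega\to\Omega$ a holomorphic map, with iterates $f^n$. Then either 1. for every $x\in\Omega$ the orbit $\{f^n(x) : n\in\mathbb{N}\}$ is relatively compact in $\Omega$; or 2. there exists $\xi\in\partial\Omega$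 such that $\lim_{n\to\infty}f^n(x)=\xi$ for every $x\in\Omega$, the convergence being uniform on compact subsets of $\Omega$. -/

import Mathlib

open Set Filter Topology MeasureTheory Metric
open scoped ENNReal

noncomputable section

/-- `Hol(Δ, Ω)`: holomorphic maps from the open unit disk `Δ = ball 0 1 ⊂ ℂ` into `Ω ⊂ ℂ^d`
(only the values on `Δ` matter). -/
def HolDisk {d : ℕ} (Ω : Set (EuclideanSpace ℂ (Fin d))) :
    Set (ℂ → EuclideanSpace ℂ (Fin d)) :=
  {φ | DifferentiableOn ℂ φ (ball 0 1) ∧ MapsTo φ (ball 0 1) Ω}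

/-- The Poincaré distance of the open unit disk, normalized so that
`ρ(0, r) = (1/2) log ((1 + r) / (1 - r))`. -/
def poincareDist (ζ η : ℂ) : ℝ :=
  (1 / 2) * Real.log
    ((1 + ‖(ζ - η) / (1 - starRingEnd ℂ η * ζ)‖) / (1 - ‖(ζ - η) / (1 - starRingEnd ℂ η * ζ)‖))

/-- `(φ 0, …, φ m; ζ 0, …, ζ (m + 1))` is an analytic chain in `Ω` joining `x` to `y`; it consists
of the `m + 1 ≥ 1` disks `φ 0, …, φ m`. -/
structure IsAnalyticChain {d : ℕ} (Ω : Set (EuclideanSpace ℂ (Fin d)))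
    (x y : EuclideanSpace ℂ (Fin d)) (m : ℕ)
    (φ : ℕ → ℂ → EuclideanSpace ℂ (Fin d)) (ζ : ℕ → ℂ) : Prop where
  hol : ∀ i ≤ m, φ i ∈ HolDisk Ω
  mem_disk : ∀ i ≤ m + 1, ζ i ∈ ball (0 : ℂ) 1
  start : φ 0 (ζ 0) = x
  link : ∀ i < m, φ i (ζ (i + 1)) = φ (i + 1) (ζ (i + 1))
  finish : φ m (ζ (m + 1)) = y

/-- The Kobayashi (pseudo-)distance `K_Ω(x, y)`. (On a domain `Ω`, any two points are joined by an
analytic chain, so that the infimum is over a non-empty set of non-negative reals.) -/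
def kobayashiDist {d : ℕ} (Ω : Set (EuclideanSpace ℂ (Fin d)))
    (x y : EuclideanSpace ℂ (Fin d)) : ℝ :=
  sInf {s : ℝ | ∃ (m : ℕ) (φ : ℕ → ℂ → EuclideanSpace ℂ (Fin d)) (ζ : ℕ → ℂ),
    IsAnalyticChain Ω x y m φ ζ ∧
      s = ∑ i ∈ Finset.range (m + 1), poincareDist (ζ i) (ζ (i + 1))}

/-- The Kobayashi–Royden (pseudo-)metric
`k_Ω(x; v) = inf {|ξ| : φ ∈ Hol(Δ, Ω), φ(0) = x, ξ φ'(0) = v}`. -/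
def kobayashiRoyden {d : ℕ} (Ω : Set (EuclideanSpace ℂ (Fin d)))
    (x v : EuclideanSpace ℂ (Fin d)) : ℝ :=
  sInf {s : ℝ | ∃ φ ∈ HolDisk Ω, ∃ ξ : ℂ, φ 0 = x ∧ ξ • deriv φ 0 = v ∧ s = ‖ξ‖}

/-- `δ_Ω(x)`, the Euclidean distance from `x` to `∂Ω`. -/
def boundaryDist {d : ℕ} (Ω : Set (EuclideanSpace ℂ (Fin d)))
    (x : EuclideanSpace ℂ (Fin d)) : ℝ :=
  infDist x (frontier Ω)

/-- `M_Ω(r) = sup {1 / k_Ω(x; v) : x ∈ Ω, δ_Ω(x) ≤ r, ‖v‖ = 1}`, as a supremum in `[0, ∞]`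
(with `1 / 0 = ∞`). -/
def kobayashiGrowth {d : ℕ} (Ω : Set (EuclideanSpace ℂ (Fin d))) (r : ℝ) : ℝ≥0∞ :=
  ⨆ (x : EuclideanSpace ℂ (Fin d)) (_ : x ∈ Ω) (_ : boundaryDist Ω x ≤ r)
    (v : EuclideanSpace ℂ (Fin d)) (_ : ‖v‖ = 1), (ENNReal.ofReal (kobayashiRoyden Ω x v))⁻¹

/-- Goldilocks domains: bounded domains in `ℂ^d` with `∫_0^ε M_Ω(r) / r dr < ∞` for some `ε > 0`
and, for each `x₀ ∈ Ω`, a bound `K_Ω(x₀, x) ≤ C + α log (1 / δ_Ω(x))` on `Ω`. -/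
structure IsGoldilocksDomain {d : ℕ} (Ω : Set (EuclideanSpace ℂ (Fin d))) : Prop where
  isOpen : IsOpen Ω
  isConnected : IsConnected Ω
  isBounded : Bornology.IsBounded Ω
  metric_growth : ∃ ε : ℝ, 0 < ε ∧
    ∫⁻ r in Ioo (0 : ℝ) ε, kobayashiGrowth Ω r / ENNReal.ofReal r < ∞
  dist_growth : ∀ x₀ ∈ Ω, ∃ C > (0 : ℝ), ∃ α > (0 : ℝ), ∀ x ∈ Ω,
    kobayashiDist Ω x₀ x ≤ C + α * Real.log (1 / boundaryDist Ω x)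

/-- `Ω` is taut: `Hol(Δ, Ω)` is a normal family, i.e. every sequence in it has a subsequence that
either converges locally uniformly on `Δ` to an element of `Hol(Δ, Ω)`, or is compactly
divergent. -/
def IsTaut {d : ℕ} (Ω : Set (EuclideanSpace ℂ (Fin d))) : Prop :=
  ∀ φ : ℕ → ℂ → EuclideanSpace ℂ (Fin d), (∀ n, φ n ∈ HolDisk Ω) →
    ∃ s : ℕ → ℕ, StrictMono s ∧
      ((∃ ψ ∈ HolDisk Ω,
          TendstoLocallyUniformlyOn (fun n => φ (s n)) ψ atTop (ball (0 : ℂ) 1)) ∨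
        (∀ A : Set ℂ, IsCompact A → A ⊆ ball (0 : ℂ) 1 →
          ∀ L : Set (EuclideanSpace ℂ (Fin d)), IsCompact L → L ⊆ Ω →
            ∀ᶠ n in atTop, Disjoint (φ (s n) '' A) L))

end

/-! A holomorphic self-map contracts the Kobayashi distance K, and the Goldilocks condition makes
the domain behave like a space of negative curvature as seen from its boundary.

Visibility (`IsGoldilocksDomain.visibility`): a nearly shortest chain of disks is turned into a
path. By the growth bound on K, a path staying near the boundary approaches it exponentially fast on
both sides of the point nearest a base point. Its Euclidean speed is at most M, so the integrability
of M(r)/r makes the displacement small. Paths between Euclidean-distant points must therefore meet a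
fixed compact set.

If some orbit has a cluster point y in Ω, then y is recurrent. Its return times have bounded gaps,
so its orbit is relatively compact (`exists_isCompact_of_recurrent`), and tautness carries this
along chains to every point.

Otherwise all orbits go to the boundary. Since M(r) tends to 0, any two of them are asymptotic in
the Euclidean metric (`tendsto_edist_iterate`), so it suffices that a single orbit converges.
Suppose it has two cluster points. A descent on K, gaining a fixed amount at each step by
visibility, shows that K(f^n o, o) tends to infinity (`not_frequently_kobayashiDist_le`). Comparing
a record time of this sequence with an earlier time then contradicts visibility
(`mapClusterPt_iterate_unique`). -/

/-! ### Disk automorphisms and the Poincaré distance -/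

/-- The automorphism `z ↦ (z + a) / (1 + conj a * z)` of the unit disk, which maps `0` to `a`. -/
noncomputable def diskShift (a z : ℂ) : ℂ := (z + a) / (1 + starRingEnd ℂ a * z)

lemma diskShift_zero_right (a : ℂ) : diskShift a 0 = a := by simp [diskShift]

lemma diskShift_neg_self (a : ℂ) : diskShift (-a) a = 0 := by simp [diskShift]

lemma one_add_conj_mul_ne_zero {a z : ℂ} (ha : a ∈ ball (0 : ℂ) 1) (hz : z ∈ ball (0 : ℂ) 1) :
    1 + starRingEnd ℂ a * z ≠ 0 := by
  rw [mem_ball_zero_iff] at ha hz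
  intro h
  have h1 : ‖starRingEnd ℂ a * z‖ = 1 := by
    rw [show starRingEnd ℂ a * z = -1 by linear_combination h]; simp
  rw [norm_mul, RCLike.norm_conj] at h1
  nlinarith [norm_nonneg a, norm_nonneg z]

lemma neg_mem_unitBall {a : ℂ} (ha : a ∈ ball (0 : ℂ) 1) : -a ∈ ball (0 : ℂ) 1 := by
  simpa using ha

lemma normSq_one_add_sub_normSq_add (a z : ℂ) :
    Complex.normSq (1 + starRingEnd ℂ a * z) - Complex.normSq (z + a)
      = (1 - Complex.normSq a) * (1 - Complex.normSq z) := by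
  simp [Complex.normSq_apply]; ring

lemma diskShift_mem {a z : ℂ} (ha : a ∈ ball (0 : ℂ) 1) (hz : z ∈ ball (0 : ℂ) 1) :
    diskShift a z ∈ ball (0 : ℂ) 1 := by
  have h0 := one_add_conj_mul_ne_zero ha hz
  rw [mem_ball_zero_iff] at *
  rw [diskShift, norm_div, div_lt_one (norm_pos_iff.2 h0)]
  refine lt_of_pow_lt_pow_left₀ 2 (norm_nonneg _) ?_
  rw [← Complex.normSq_eq_norm_sq, ← Complex.normSq_eq_norm_sq]
  have := normSq_one_add_sub_normSq_add a z
  have h1 : 0 < (1 - Complex.normSq a) * (1 - Complex.normSq z) := by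
    rw [Complex.normSq_eq_norm_sq, Complex.normSq_eq_norm_sq]
    apply mul_pos <;> nlinarith [norm_nonneg a, norm_nonneg z]
  linarith

lemma diskShift_neg_diskShift {a z : ℂ} (ha : a ∈ ball (0 : ℂ) 1) (hz : z ∈ ball (0 : ℂ) 1) :
    diskShift (-a) (diskShift a z) = z := by
  have h0 := one_add_conj_mul_ne_zero ha hz
  have h1 := one_add_conj_mul_ne_zero (neg_mem_unitBall ha) (diskShift_mem ha hz)
  unfold diskShift at *
  rw [div_eq_iff h1]
  simp only [map_neg] at *
  linear_combination div_mul_cancel₀ (z + a) h0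

lemma differentiableOn_diskShift {a : ℂ} (ha : a ∈ ball (0 : ℂ) 1) :
    DifferentiableOn ℂ (diskShift a) (ball 0 1) := by
  unfold diskShift
  exact DifferentiableOn.div (by fun_prop) (by fun_prop)
    fun z hz => one_add_conj_mul_ne_zero ha hz

lemma hasDerivAt_diskShift_zero (a : ℂ) :
    HasDerivAt (diskShift a) ((1 - ‖a‖ ^ 2 : ℝ) : ℂ) 0 := by
  have h1 : HasDerivAt (fun z : ℂ => z + a) 1 0 := (hasDerivAt_id _).add_const a
  have h2 : HasDerivAt (fun z : ℂ => 1 + starRingEnd ℂ a * z) (starRingEnd ℂ a) 0 := by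
    simpa using ((hasDerivAt_id (0 : ℂ)).const_mul (starRingEnd ℂ a)).const_add 1
  have h3 := h1.div h2 (by simp)
  refine h3.congr_deriv ?_
  simp [Complex.mul_conj']

lemma poincareDist_eq_artanh {ζ η : ℂ} (hζ : ζ ∈ ball (0 : ℂ) 1) (hη : η ∈ ball (0 : ℂ) 1) :
    poincareDist ζ η = Real.artanh ‖diskShift (-η) ζ‖ := by
  have h := mem_ball_zero_iff.1 (diskShift_mem (neg_mem_unitBall hη) hζ)
  rw [Real.artanh_eq_half_log ⟨by linarith [norm_nonneg (diskShift (-η) ζ)], h.le⟩]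
  simp [poincareDist, diskShift, sub_eq_add_neg]

lemma poincareDist_nonneg {ζ η : ℂ} (hζ : ζ ∈ ball (0 : ℂ) 1) (hη : η ∈ ball (0 : ℂ) 1) :
    0 ≤ poincareDist ζ η := by
  rw [poincareDist_eq_artanh hζ hη]; exact Real.artanh_nonneg (norm_nonneg _)

lemma poincareDist_comm (ζ η : ℂ) : poincareDist ζ η = poincareDist η ζ := by
  have h : ‖(ζ - η) / (1 - starRingEnd ℂ η * ζ)‖ = ‖(η - ζ) / (1 - starRingEnd ℂ ζ * η)‖ := by
    rw [norm_div, norm_div, norm_sub_rev]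
    congr 1
    rw [← RCLike.norm_conj]
    simp [mul_comm]
  rw [poincareDist, poincareDist, h]

lemma poincareDist_self (ζ : ℂ) : poincareDist ζ ζ = 0 := by simp [poincareDist]

lemma le_artanh {x : ℝ} (h0 : 0 ≤ x) (h1 : x < 1) : x ≤ Real.artanh x := by
  rw [Real.artanh_eq_half_log ⟨by linarith, h1.le⟩]
  have h2 : 0 < 1 - x := by linarith
  -- The bound 2u/(u+2) ≤ log(1+u) at u = 2x/(1-x) reads 2x ≤ log((1+x)/(1-x)).
  have h := Real.le_log_one_add_of_nonneg (x := 2 * x / (1 - x)) (by positivity)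
  have e1 : 2 * (2 * x / (1 - x)) / (2 * x / (1 - x) + 2) = 2 * x := by
    have : 2 * x + 2 * (1 - x) ≠ 0 := by linarith
    field_simp
    ring
  have e2 : 1 + 2 * x / (1 - x) = (1 + x) / (1 - x) := by
    field_simp
    ring
  rw [e1, e2] at h
  linarith

/-- Any disk can be reparametrized so that a prescribed point of the disk plays the role of `ζ`,
without changing the Poincaré distance between the marked points. -/
lemma exists_reparam {ζ η c : ℂ} (hζ : ζ ∈ ball (0 : ℂ) 1) (hη : η ∈ ball (0 : ℂ) 1)
    (hc : c ∈ ball (0 : ℂ) 1) :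
    ∃ g : ℂ → ℂ, DifferentiableOn ℂ g (ball 0 1) ∧ MapsTo g (ball 0 1) (ball 0 1) ∧ g c = ζ ∧
      ∃ c' ∈ ball (0 : ℂ) 1, g c' = η ∧ poincareDist c c' = poincareDist ζ η := by
  have hw := diskShift_mem (neg_mem_unitBall hζ) hη
  have hm : MapsTo (diskShift (-c)) (ball 0 1) (ball 0 1) :=
    fun z hz => diskShift_mem (neg_mem_unitBall hc) hz
  refine ⟨diskShift ζ ∘ diskShift (-c),
    (differentiableOn_diskShift hζ).comp (differentiableOn_diskShift (neg_mem_unitBall hc)) hm,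
    fun z hz => diskShift_mem hζ (hm hz), ?_, diskShift c (diskShift (-ζ) η),
    diskShift_mem hc hw, ?_, ?_⟩
  · simp [diskShift_neg_self, diskShift_zero_right]
  · simp only [Function.comp, diskShift_neg_diskShift hc hw]
    simpa using diskShift_neg_diskShift (neg_mem_unitBall hζ) hη
  · rw [poincareDist_comm, poincareDist_eq_artanh (diskShift_mem hc hw) hc,
      diskShift_neg_diskShift hc hw, poincareDist_comm ζ, poincareDist_eq_artanh hη hζ]

/-! ### Chains of disks and the Kobayashi distance -/

section Chains

variable {d : ℕ} {Ω : Set (EuclideanSpace ℂ (Fin d))}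

/-- `ChainJoin Ω x y ℓ`: the points `x` and `y` are joined by a finite succession of holomorphic
disks in `Ω` of total length `ℓ`. -/
inductive ChainJoin {d : ℕ} (Ω : Set (EuclideanSpace ℂ (Fin d))) (x : EuclideanSpace ℂ (Fin d)) :
    EuclideanSpace ℂ (Fin d) → ℝ → Prop
  | refl (hx : x ∈ Ω) : ChainJoin Ω x x 0
  | snoc {a : ℝ} {φ : ℂ → EuclideanSpace ℂ (Fin d)} {ζ η : ℂ} (hφ : φ ∈ HolDisk Ω)
      (hζ : ζ ∈ ball (0 : ℂ) 1) (hη : η ∈ ball (0 : ℂ) 1) (h : ChainJoin Ω x (φ ζ) a) :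
      ChainJoin Ω x (φ η) (a + poincareDist ζ η)

lemma HolDisk.comp {φ : ℂ → EuclideanSpace ℂ (Fin d)} (hφ : φ ∈ HolDisk Ω) {g : ℂ → ℂ}
    (hg : DifferentiableOn ℂ g (ball 0 1)) (hm : MapsTo g (ball 0 1) (ball 0 1)) :
    φ ∘ g ∈ HolDisk Ω :=
  ⟨hφ.1.comp hg hm, hφ.2.comp hm⟩

lemma HolDisk.map {φ : ℂ → EuclideanSpace ℂ (Fin d)} (hφ : φ ∈ HolDisk Ω)
    {f : EuclideanSpace ℂ (Fin d) → EuclideanSpace ℂ (Fin d)}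
    (hf : DifferentiableOn ℂ f Ω) (hm : MapsTo f Ω Ω) : f ∘ φ ∈ HolDisk Ω :=
  ⟨hf.comp hφ.1 hφ.2, hm.comp hφ.2⟩

lemma const_mem_holDisk {x : EuclideanSpace ℂ (Fin d)} (hx : x ∈ Ω) :
    (fun _ : ℂ => x) ∈ HolDisk Ω :=
  ⟨differentiableOn_const _, fun _ _ => hx⟩

namespace ChainJoin

variable {x y z : EuclideanSpace ℂ (Fin d)} {a b : ℝ}

lemma right_mem (h : ChainJoin Ω x y a) : y ∈ Ω := by
  cases h with
  | refl hx => exact hx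
  | snoc hφ _ hη _ => exact hφ.2 hη

lemma nonneg (h : ChainJoin Ω x y a) : 0 ≤ a := by
  induction h with
  | refl hx => exact le_rfl
  | snoc _ hζ hη _ ih => exact add_nonneg ih (poincareDist_nonneg hζ hη)

lemma disk {φ : ℂ → EuclideanSpace ℂ (Fin d)} {ζ η : ℂ} (hφ : φ ∈ HolDisk Ω)
    (hζ : ζ ∈ ball (0 : ℂ) 1) (hη : η ∈ ball (0 : ℂ) 1) :
    ChainJoin Ω (φ ζ) (φ η) (poincareDist ζ η) := by
  simpa using snoc hφ hζ hη (refl (hφ.2 hζ))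

lemma trans (h₁ : ChainJoin Ω x y a) (h₂ : ChainJoin Ω y z b) : ChainJoin Ω x z (a + b) := by
  induction h₂ with
  | refl hx => simpa using h₁
  | snoc hφ hζ hη _ ih => rw [← add_assoc]; exact snoc hφ hζ hη ih

lemma symm (h : ChainJoin Ω x y a) : ChainJoin Ω y x a := by
  induction h with
  | refl hx => exact refl hx
  | snoc hφ hζ hη _ ih =>
    rw [add_comm, poincareDist_comm]
    exact (disk hφ hη hζ).trans ih

lemma map {f : EuclideanSpace ℂ (Fin d) → EuclideanSpace ℂ (Fin d)}
    (hf : DifferentiableOn ℂ f Ω) (hm : MapsTo f Ω Ω) (h : ChainJoin Ω x y a) :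
    ChainJoin Ω (f x) (f y) a := by
  induction h with
  | refl hx => exact refl (hm hx)
  | snoc hφ hζ hη _ ih => exact snoc (φ := f ∘ _) (HolDisk.map hφ hf hm) hζ hη ih

lemma of_isAnalyticChain {m : ℕ} {φ : ℕ → ℂ → EuclideanSpace ℂ (Fin d)} {ζ : ℕ → ℂ}
    (h : IsAnalyticChain Ω x y m φ ζ) :
    ChainJoin Ω x y (∑ i ∈ Finset.range (m + 1), poincareDist (ζ i) (ζ (i + 1))) := by
  have key : ∀ k ≤ m, ChainJoin Ω x (φ k (ζ (k + 1)))
      (∑ i ∈ Finset.range (k + 1), poincareDist (ζ i) (ζ (i + 1))) := by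
    intro k
    induction k with
    | zero =>
      intro _
      have := disk (h.hol 0 (by omega)) (h.mem_disk 0 (by omega)) (h.mem_disk 1 (by omega))
      rw [h.start] at this
      simpa using this
    | succ k ih =>
      intro hk
      have := ih (by omega)
      rw [h.link k (by omega)] at this
      rw [Finset.sum_range_succ]
      exact snoc (h.hol _ hk) (h.mem_disk _ (by omega)) (h.mem_disk _ (by omega)) this
  simpa [h.finish] using key m le_rfl

/-- Consecutive disks of an analytic chain share the parameter of their common point, whereas each
step of `ChainJoin` has its own two parameters. A disk automorphism moves the initial parameter of
each new disk to the final one of the chain so far. The inductive form thus gives the same infimum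
and permits proofs by induction. -/
lemma exists_isAnalyticChain (h : ChainJoin Ω x y a) :
    ∃ (m : ℕ) (φ : ℕ → ℂ → EuclideanSpace ℂ (Fin d)) (ζ : ℕ → ℂ),
      IsAnalyticChain Ω x y m φ ζ ∧
        a = ∑ i ∈ Finset.range (m + 1), poincareDist (ζ i) (ζ (i + 1)) := by
  induction h with
  | refl hx =>
    exact ⟨0, fun _ _ => x, fun _ => 0, ⟨fun _ _ => const_mem_holDisk hx, by simp, rfl, by simp,
      rfl⟩, by simp [poincareDist_self]⟩
  | @snoc a ψ ζ₀ η₀ hψ hζ hη _ ih =>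
    obtain ⟨m, φ, ζ, hc, rfl⟩ := ih
    obtain ⟨g, hg, hgm, hgc, c', hc', hgc', hρ⟩ :=
      exists_reparam hζ hη (hc.mem_disk (m + 1) le_rfl)
    refine ⟨m + 1, Function.update φ (m + 1) (ψ ∘ g), Function.update ζ (m + 2) c',
      ⟨?_, ?_, ?_, ?_, ?_⟩, ?_⟩
    · intro i hi
      rcases eq_or_ne i (m + 1) with rfl | hne
      · simpa using HolDisk.comp hψ hg hgm
      · simpa [hne] using hc.hol i (by omega)
    · intro i hi
      rcases eq_or_ne i (m + 2) with rfl | hne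
      · simpa using hc'
      · rw [Function.update_of_ne hne]
        exact hc.mem_disk i (by omega)
    · rw [Function.update_of_ne (by omega), Function.update_of_ne (by omega)]
      exact hc.start
    · intro i hi
      rw [Function.update_of_ne (by omega), Function.update_of_ne (by omega : i + 1 ≠ m + 2)]
      rcases eq_or_ne i m with rfl | hne
      · simp [hgc, hc.finish]
      · rw [Function.update_of_ne (by omega)]
        exact hc.link i (by omega)
    · simp [hgc']
    · rw [Finset.sum_range_succ _ (m + 1), Function.update_of_ne (by omega), Function.update_self,
        hρ]
      congr 1
      refine Finset.sum_congr rfl fun i hi => ?_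
      rw [Finset.mem_range] at hi
      rw [Function.update_of_ne (by omega), Function.update_of_ne (by omega)]

end ChainJoin

lemma kobayashiDist_eq (x y : EuclideanSpace ℂ (Fin d)) :
    kobayashiDist Ω x y = sInf {s | ChainJoin Ω x y s} := by
  unfold kobayashiDist
  congr 1
  ext s
  constructor
  · rintro ⟨m, φ, ζ, h, rfl⟩
    exact .of_isAnalyticChain h
  · exact fun h => h.exists_isAnalyticChain

variable {x y z : EuclideanSpace ℂ (Fin d)} {a : ℝ}

lemma ChainJoin.kobayashiDist_le (h : ChainJoin Ω x y a) : kobayashiDist Ω x y ≤ a := by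
  rw [kobayashiDist_eq]
  exact csInf_le ⟨0, fun _ h => h.nonneg⟩ h

lemma kobayashiDist_nonneg : 0 ≤ kobayashiDist Ω x y := by
  rw [kobayashiDist_eq]
  exact Real.sInf_nonneg fun _ h => h.nonneg

lemma kobayashiDist_comm (x y : EuclideanSpace ℂ (Fin d)) :
    kobayashiDist Ω x y = kobayashiDist Ω y x := by
  rw [kobayashiDist_eq, kobayashiDist_eq]
  congr 1
  ext s
  exact ⟨.symm, .symm⟩

lemma kobayashiDist_self (hx : x ∈ Ω) : kobayashiDist Ω x x = 0 :=
  le_antisymm (ChainJoin.refl hx).kobayashiDist_le kobayashiDist_nonneg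

lemma chainJoin_of_mem_ball {s : ℝ} (hs : ball x s ⊆ Ω) (hy : y ∈ ball x s) :
    ChainJoin Ω x y (Real.artanh (dist y x / s)) := by
  have hs0 : 0 < s := dist_nonneg.trans_lt hy
  have ht : dist y x / s < 1 := (div_lt_one hs0).2 hy
  set t : ℝ := dist y x / s with htdef
  have ht0 : 0 ≤ t := by positivity
  rcases eq_or_ne y x with rfl | hne
  · simpa [htdef] using ChainJoin.refl (hs hy)
  have hd : 0 < dist y x := dist_pos.2 hne
  -- The affine disk of radius `s` centred at `x` in the direction of `y`; it reaches `y` at the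
  -- parameter `t`.
  have hφ : (fun ζ : ℂ => x + (ζ * ((s / dist y x : ℝ) : ℂ)) • (y - x)) ∈ HolDisk Ω := by
    refine ⟨by fun_prop, fun ζ hζ => hs ?_⟩
    rw [mem_ball_zero_iff] at hζ
    rw [mem_ball, dist_self_add_left, norm_smul, norm_mul, Complex.norm_real,
      Real.norm_of_nonneg (by positivity), ← dist_eq_norm, mul_assoc, div_mul_cancel₀ _ hd.ne']
    nlinarith
  have ht1 : ((t : ℝ) : ℂ) ∈ ball (0 : ℂ) 1 := by
    rw [mem_ball_zero_iff, Complex.norm_real, Real.norm_of_nonneg ht0]; exact ht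
  have h := ChainJoin.disk hφ (mem_ball_self one_pos) ht1
  rw [poincareDist_comm, poincareDist_eq_artanh ht1 (mem_ball_self one_pos)] at h
  have e : ((t : ℝ) : ℂ) * ((s / dist y x : ℝ) : ℂ) = 1 := by
    rw [← Complex.ofReal_mul, htdef, div_mul_div_cancel₀ hs0.ne', div_self hd.ne',
      Complex.ofReal_one]
  beta_reduce at h
  rw [e] at h
  simpa [diskShift, abs_of_nonneg ht0] using h

/-- Points close to a given point of an open set are joined to it by short chains. -/
lemma eventually_kobayashiDist_lt (hΩ : IsOpen Ω) (hx : x ∈ Ω) {ε : ℝ} (hε : 0 < ε) :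
    ∀ᶠ y in 𝓝 x, y ∈ Ω ∧ kobayashiDist Ω x y < ε := by
  obtain ⟨s, hs, hsub⟩ := Metric.isOpen_iff.1 hΩ x hx
  have hc : Tendsto (fun y => Real.artanh (dist y x / s)) (𝓝 x) (𝓝 0) := by
    have h1 : Tendsto (fun y => dist y x / s) (𝓝 x) (𝓝 0) := by
      have : Continuous fun y => dist y x / s := by fun_prop
      simpa using this.tendsto x
    have h2 : ContinuousAt Real.artanh 0 := by
      unfold Real.artanh
      refine ContinuousAt.log ?_ (by simp)
      refine ContinuousAt.sqrt ?_
      exact ContinuousAt.div (by fun_prop) (by fun_prop) (by simp)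
    have h3 := h2.tendsto.comp h1
    rwa [Real.artanh_zero] at h3
  filter_upwards [hc.eventually (gt_mem_nhds hε), ball_mem_nhds x hs] with y hy hyb
  exact ⟨hsub hyb, (chainJoin_of_mem_ball hsub hyb).kobayashiDist_le.trans_lt hy⟩

lemma exists_chainJoin (hΩ : IsOpen Ω) (hc : IsPreconnected Ω) (hx : x ∈ Ω) (hy : y ∈ Ω) :
    ∃ a, ChainJoin Ω x y a := by
  refine hc.induction₂ (fun x y => ∃ a, ChainJoin Ω x y a) ?_ ?_ ?_ hx hy
  · intro x hx
    obtain ⟨s, hs, hsub⟩ := Metric.isOpen_iff.1 hΩ x hx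
    filter_upwards [mem_nhdsWithin_of_mem_nhds (ball_mem_nhds x hs)] with y hyb
    exact ⟨_, chainJoin_of_mem_ball hsub hyb⟩
  · rintro x y z _ _ _ ⟨a, ha⟩ ⟨b, hb⟩
    exact ⟨_, ha.trans hb⟩
  · rintro x y _ _ ⟨a, ha⟩
    exact ⟨a, ha.symm⟩

lemma exists_chainJoin_lt (hΩ : IsOpen Ω) (hc : IsPreconnected Ω) (hx : x ∈ Ω) (hy : y ∈ Ω)
    (ha : kobayashiDist Ω x y < a) : ∃ b < a, ChainJoin Ω x y b := by
  rw [kobayashiDist_eq] at ha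
  obtain ⟨b, hb, hba⟩ := exists_lt_of_csInf_lt (exists_chainJoin hΩ hc hx hy) ha
  exact ⟨b, hba, hb⟩

lemma kobayashiDist_triangle (hΩ : IsOpen Ω) (hc : IsPreconnected Ω) (hx : x ∈ Ω) (hy : y ∈ Ω)
    (hz : z ∈ Ω) : kobayashiDist Ω x z ≤ kobayashiDist Ω x y + kobayashiDist Ω y z := by
  refine le_of_forall_pos_lt_add fun ε hε => ?_
  obtain ⟨a, ha, hxy⟩ := exists_chainJoin_lt hΩ hc hx hy
    (show kobayashiDist Ω x y < kobayashiDist Ω x y + ε / 2 by linarith)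
  obtain ⟨b, hb, hyz⟩ := exists_chainJoin_lt hΩ hc hy hz
    (show kobayashiDist Ω y z < kobayashiDist Ω y z + ε / 2 by linarith)
  linarith [(hxy.trans hyz).kobayashiDist_le]

lemma kobayashiDist_map_le (hΩ : IsOpen Ω) (hc : IsPreconnected Ω)
    {f : EuclideanSpace ℂ (Fin d) → EuclideanSpace ℂ (Fin d)} (hf : DifferentiableOn ℂ f Ω)
    (hm : MapsTo f Ω Ω) (hx : x ∈ Ω) (hy : y ∈ Ω) :
    kobayashiDist Ω (f x) (f y) ≤ kobayashiDist Ω x y := by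
  refine le_of_forall_pos_lt_add fun ε hε => ?_
  obtain ⟨a, ha, hxy⟩ := exists_chainJoin_lt hΩ hc hx hy
    (show kobayashiDist Ω x y < kobayashiDist Ω x y + ε by linarith)
  exact (hxy.map hf hm).kobayashiDist_le.trans_lt ha

/-- On a bounded domain the Kobayashi distance dominates a multiple of the Euclidean distance. -/
lemma exists_dist_le_mul_kobayashiDist (hΩ : IsOpen Ω) (hc : IsPreconnected Ω)
    (hb : Bornology.IsBounded Ω) :
    ∃ D > 0, ∀ x ∈ Ω, ∀ y ∈ Ω, dist x y ≤ D * kobayashiDist Ω x y := by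
  obtain ⟨D, hD0, hD⟩ := hb.subset_ball_lt 0 0
  have hdiam : ∀ x ∈ Ω, ∀ y ∈ Ω, dist x y ≤ 2 * D := fun x hx y hy => by
    have h1 := mem_ball.1 (hD hx)
    have h2 := mem_ball.1 (hD hy)
    linarith [dist_triangle_right x y 0]
  have key : ∀ {x y a}, ChainJoin Ω x y a → dist x y ≤ 2 * D * a := by
    intro x y a h
    induction h with
    | refl hx => simp
    | @snoc a φ ζ η hφ hζ hη h ih =>
      have hw := diskShift_mem (neg_mem_unitBall hζ) hη
      have hm : MapsTo (diskShift ζ) (ball 0 1) (ball 0 1) := fun z hz => diskShift_mem hζ hz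
      have hψ := HolDisk.comp hφ (differentiableOn_diskShift hζ) hm
      -- Schwarz lemma for the disk recentred at `ζ`, whose image has diameter at most 2D.
      have h1 := Complex.dist_le_div_mul_dist_of_mapsTo_ball (R₂ := 2 * D) hψ.1
        (fun z hz => mem_closedBall.2
          (hdiam _ (hψ.2 hz) _ (hψ.2 (mem_ball_self one_pos)))) hw
      have e : diskShift ζ (diskShift (-ζ) η) = η := by
        simpa using diskShift_neg_diskShift (neg_mem_unitBall hζ) hη
      simp only [Function.comp, e, diskShift_zero_right, div_one, dist_zero_right] at h1
      have h2 : ‖diskShift (-ζ) η‖ ≤ poincareDist ζ η := by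
        rw [poincareDist_comm, poincareDist_eq_artanh hη hζ]
        exact le_artanh (norm_nonneg _) (mem_ball_zero_iff.1 hw)
      have h3 : dist (φ η) (φ ζ) ≤ 2 * D * poincareDist ζ η := h1.trans (by gcongr)
      have h4 := dist_triangle_right x (φ η) (φ ζ)
      linarith
  refine ⟨2 * D, by positivity, fun x hx y hy => ?_⟩
  refine le_of_forall_pos_lt_add fun ε hε => ?_
  obtain ⟨a, ha, hxy⟩ := exists_chainJoin_lt hΩ hc hx hy
    (show kobayashiDist Ω x y < kobayashiDist Ω x y + ε / (2 * D) by
      linarith [show 0 < ε / (2 * D) by positivity])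
  calc dist x y ≤ 2 * D * a := key hxy
    _ < 2 * D * (kobayashiDist Ω x y + ε / (2 * D)) := by gcongr
    _ = _ := by field_simp

end Chains

/-! ### Paths of controlled speed along chains of disks -/

lemma Real.hasDerivAt_tanh' (t : ℝ) : HasDerivAt Real.tanh (1 - Real.tanh t ^ 2) t := by
  have h := (Real.hasDerivAt_sinh t).div (Real.hasDerivAt_cosh t) (Real.cosh_pos t).ne'
  have e : Real.tanh = Real.sinh / Real.cosh := by
    ext x; simp [Real.tanh_eq_sinh_div_cosh]
  rw [e]
  refine h.congr_deriv ?_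
  have := (Real.cosh_pos t).ne'
  simp only [Pi.div_apply]
  field_simp

lemma Real.tanh_sub_eq (s t : ℝ) :
    (Real.tanh t - Real.tanh s) / (1 - Real.tanh s * Real.tanh t) = Real.tanh (t - s) := by
  have h1 := (Real.cosh_pos t).ne'
  have h2 := (Real.cosh_pos s).ne'
  have h3 := (Real.cosh_pos (t - s)).ne'
  rw [Real.cosh_sub] at h3
  simp only [Real.tanh_eq_sinh_div_cosh, Real.sinh_sub, Real.cosh_sub]
  have h4 : 1 - Real.sinh s / Real.cosh s * (Real.sinh t / Real.cosh t) ≠ 0 := by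
    intro h
    apply h3
    field_simp at h
    linarith
  rw [div_eq_div_iff h4 h3]
  field_simp

lemma tanh_mul_mem_ball {u : ℂ} (hu : ‖u‖ = 1) (t : ℝ) :
    (Real.tanh t : ℂ) * u ∈ ball (0 : ℂ) 1 := by
  rw [mem_ball_zero_iff, norm_mul, hu, mul_one, Complex.norm_real, Real.norm_eq_abs]
  exact abs_lt.2 ⟨Real.neg_one_lt_tanh t, Real.tanh_lt_one t⟩

lemma poincareDist_tanh_mul {u : ℂ} (hu : ‖u‖ = 1) {s t : ℝ} (hst : s ≤ t) :
    poincareDist ((Real.tanh s : ℂ) * u) ((Real.tanh t : ℂ) * u) = t - s := by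
  rw [poincareDist_comm, poincareDist_eq_artanh (tanh_mul_mem_ball hu t) (tanh_mul_mem_ball hu s)]
  have e : diskShift (-((Real.tanh s : ℂ) * u)) ((Real.tanh t : ℂ) * u)
      = ((Real.tanh (t - s) : ℝ) : ℂ) * u := by
    rw [← Real.tanh_sub_eq]
    have h : starRingEnd ℂ u * u = 1 := by rw [Complex.conj_mul', hu]; simp
    simp only [diskShift, map_neg, map_mul, Complex.conj_ofReal, Complex.ofReal_div,
      Complex.ofReal_sub, Complex.ofReal_mul, Complex.ofReal_one]
    rw [show (1 : ℂ) + -((Real.tanh s : ℂ) * starRingEnd ℂ u) * ((Real.tanh t : ℂ) * u)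
      = 1 - Real.tanh s * Real.tanh t by linear_combination -(Real.tanh s * Real.tanh t : ℂ) * h]
    ring
  rw [e, norm_mul, hu, mul_one, Complex.norm_real, Real.norm_eq_abs, abs_of_nonneg,
    Real.artanh_tanh]
  have := Real.sinh_nonneg_iff.2 (sub_nonneg.2 hst)
  rw [Real.tanh_eq_sinh_div_cosh]
  exact div_nonneg this (Real.cosh_pos _).le

/-- Two points of the disk are joined by the image of a radius under a disk automorphism. -/
lemma exists_geodesic_reparam {ζ η : ℂ} (hζ : ζ ∈ ball (0 : ℂ) 1) (hη : η ∈ ball (0 : ℂ) 1) :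
    ∃ g : ℂ → ℂ, DifferentiableOn ℂ g (ball 0 1) ∧ MapsTo g (ball 0 1) (ball 0 1) ∧
      ∃ u : ℂ, ‖u‖ = 1 ∧ g 0 = ζ ∧ g ((Real.tanh (poincareDist ζ η) : ℂ) * u) = η := by
  have hw := diskShift_mem (neg_mem_unitBall hζ) hη
  obtain ⟨u, hu, huw⟩ : ∃ u : ℂ, ‖u‖ = 1 ∧
      ((‖diskShift (-ζ) η‖ : ℝ) : ℂ) * u = diskShift (-ζ) η := by
    rcases eq_or_ne (diskShift (-ζ) η) 0 with h | h
    · exact ⟨1, by simp, by simp [h]⟩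
    · refine ⟨diskShift (-ζ) η / (‖diskShift (-ζ) η‖ : ℝ), by simp [h], ?_⟩
      rw [mul_div_cancel₀]
      simpa using h
  refine ⟨diskShift ζ, differentiableOn_diskShift hζ, fun z hz => diskShift_mem hζ hz, u, hu,
    diskShift_zero_right ζ, ?_⟩
  rw [poincareDist_comm, poincareDist_eq_artanh hη hζ, Real.tanh_artanh
    ⟨by linarith [norm_nonneg (diskShift (-ζ) η)], mem_ball_zero_iff.1 hw⟩, huw]
  simpa using diskShift_neg_diskShift (neg_mem_unitBall hζ) hη

section Paths

variable {d : ℕ} {Ω : Set (EuclideanSpace ℂ (Fin d))}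

lemma ofReal_norm_deriv_zero_le_kobayashiGrowth {φ : ℂ → EuclideanSpace ℂ (Fin d)}
    (hφ : φ ∈ HolDisk Ω) {r : ℝ} (hr : boundaryDist Ω (φ 0) ≤ r) :
    ENNReal.ofReal ‖deriv φ 0‖ ≤ kobayashiGrowth Ω r := by
  rcases eq_or_ne (deriv φ 0) 0 with h0 | h0
  · simp [h0]
  have hn : 0 < ‖deriv φ 0‖ := norm_pos_iff.2 h0
  set ξ : ℂ := ((‖deriv φ 0‖⁻¹ : ℝ) : ℂ)
  have hξ : ‖ξ‖ = ‖deriv φ 0‖⁻¹ := by simp [ξ]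
  have hv : ‖ξ • deriv φ 0‖ = 1 := by rw [norm_smul, hξ, inv_mul_cancel₀ hn.ne']
  have hk : kobayashiRoyden Ω (φ 0) (ξ • deriv φ 0) ≤ ‖deriv φ 0‖⁻¹ := by
    refine csInf_le ⟨0, ?_⟩ ⟨φ, hφ, ξ, rfl, rfl, hξ.symm⟩
    rintro _ ⟨_, _, _, _, _, rfl⟩
    exact norm_nonneg _
  unfold kobayashiGrowth
  refine le_iSup₂_of_le (φ 0) (hφ.2 (mem_ball_self one_pos)) (le_iSup₂_of_le hr (ξ • deriv φ 0)
    (le_iSup_of_le hv ?_))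
  rw [ENNReal.le_inv_iff_le_inv, ← ENNReal.ofReal_inv_of_pos hn]
  exact ENNReal.ofReal_le_ofReal hk

/-- Precomposing with the automorphism sending 0 to `ζ` multiplies the derivative by 1 - |ζ|² and
reduces to the centre of the disk. -/
lemma ofReal_mul_norm_deriv_le_kobayashiGrowth {φ : ℂ → EuclideanSpace ℂ (Fin d)}
    (hφ : φ ∈ HolDisk Ω) {ζ : ℂ} (hζ : ζ ∈ ball (0 : ℂ) 1) {r : ℝ}
    (hr : boundaryDist Ω (φ ζ) ≤ r) :
    ENNReal.ofReal ((1 - ‖ζ‖ ^ 2) * ‖deriv φ ζ‖) ≤ kobayashiGrowth Ω r := by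
  have hm : MapsTo (diskShift ζ) (ball 0 1) (ball 0 1) := fun z hz => diskShift_mem hζ hz
  have hψ := HolDisk.comp hφ (differentiableOn_diskShift hζ) hm
  have hd : HasDerivAt φ (deriv φ ζ) (diskShift ζ 0) := by
    rw [diskShift_zero_right]
    exact (hφ.1.differentiableAt (isOpen_ball.mem_nhds hζ)).hasDerivAt
  have h := ofReal_norm_deriv_zero_le_kobayashiGrowth hψ (r := r)
    (by simpa [diskShift_zero_right] using hr)
  rw [(hd.scomp 0 (hasDerivAt_diskShift_zero ζ)).deriv, norm_smul, Complex.norm_real,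
    Real.norm_of_nonneg] at h
  · exact h
  · nlinarith [norm_nonneg ζ, mem_ball_zero_iff.1 hζ]

/-- `σ` is a path in `Ω`, defined on `[0, ℓ]`, whose arcs are joined by chains of disks of the same
length and which moves at speed at most `M_Ω(r)` while its distance to `∂Ω` is at most `r`. -/
structure IsChainPath {d : ℕ} (Ω : Set (EuclideanSpace ℂ (Fin d)))
    (σ : ℝ → EuclideanSpace ℂ (Fin d)) (ℓ : ℝ) : Prop where
  join : ∀ s t, 0 ≤ s → s ≤ t → t ≤ ℓ → ChainJoin Ω (σ s) (σ t) (t - s)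
  edist_le : ∀ s t, 0 ≤ s → s ≤ t → t ≤ ℓ → ∀ r, (∀ u ∈ Icc s t, boundaryDist Ω (σ u) ≤ r) →
    edist (σ s) (σ t) ≤ kobayashiGrowth Ω r * ENNReal.ofReal (t - s)

/-- The radius t ↦ tanh(t) u has unit Poincaré speed, so its image moves at Euclidean speed (1 -
|ζ|²)‖φ'(ζ)‖, which M bounds; the mean value inequality integrates this. -/
lemma isChainPath_disk {φ : ℂ → EuclideanSpace ℂ (Fin d)} (hφ : φ ∈ HolDisk Ω) {u : ℂ}
    (hu : ‖u‖ = 1) (ℓ : ℝ) : IsChainPath Ω (fun t => φ ((Real.tanh t : ℂ) * u)) ℓ := by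
  constructor
  · intro s t _ hst _
    have := ChainJoin.disk hφ (tanh_mul_mem_ball hu s) (tanh_mul_mem_ball hu t)
    rwa [poincareDist_tanh_mul hu hst] at this
  · intro s t _ hst _ r hr
    rcases hst.eq_or_lt with rfl | hlt
    · simp
    by_cases htop : kobayashiGrowth Ω r = ⊤
    · rw [htop, ENNReal.top_mul (by simpa using hlt)]
      exact le_top
    have hder : ∀ x ∈ Icc s t, HasDerivWithinAt (fun t : ℝ => φ ((Real.tanh t : ℂ) * u))
        ((((1 - Real.tanh x ^ 2 : ℝ) : ℂ) * u) • deriv φ ((Real.tanh x : ℂ) * u)) (Icc s t) x := by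
      intro x _
      have h1 : HasDerivAt (fun t : ℝ => (Real.tanh t : ℂ) * u)
          (((1 - Real.tanh x ^ 2 : ℝ) : ℂ) * u) x :=
        (Real.hasDerivAt_tanh' x).ofReal_comp.mul_const u
      have h2 := (hφ.1.differentiableAt
        (isOpen_ball.mem_nhds (tanh_mul_mem_ball hu x))).hasDerivAt
      exact (h2.scomp x h1).hasDerivWithinAt
    have hbd : ∀ x ∈ Ico s t,
        ‖(((1 - Real.tanh x ^ 2 : ℝ) : ℂ) * u) • deriv φ ((Real.tanh x : ℂ) * u)‖
          ≤ (kobayashiGrowth Ω r).toReal := by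
      intro x hx
      have h := ofReal_mul_norm_deriv_le_kobayashiGrowth hφ (tanh_mul_mem_ball hu x)
        (hr x (Ico_subset_Icc_self hx))
      rw [norm_mul, hu, mul_one, Complex.norm_real, Real.norm_eq_abs, sq_abs] at h
      rw [norm_smul, norm_mul, hu, mul_one, Complex.norm_real, Real.norm_of_nonneg]
      · exact (ENNReal.ofReal_le_iff_le_toReal htop).1 h
      · nlinarith [Real.neg_one_lt_tanh x, Real.tanh_lt_one x]
    have h := norm_image_sub_le_of_norm_deriv_le_segment' hder hbd t ⟨hst, le_rfl⟩
    rw [edist_comm, edist_dist, dist_eq_norm, ← ENNReal.ofReal_toReal htop,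
      ← ENNReal.ofReal_mul ENNReal.toReal_nonneg]
    exact ENNReal.ofReal_le_ofReal h

lemma IsChainPath.append {σ τ : ℝ → EuclideanSpace ℂ (Fin d)} {a b : ℝ} (hσ : IsChainPath Ω σ a)
    (hτ : IsChainPath Ω τ b) (h : σ a = τ 0) :
    IsChainPath Ω (fun t => if t ≤ a then σ t else τ (t - a)) (a + b) := by
  have hval : ∀ t, a ≤ t → (if t ≤ a then σ t else τ (t - a)) = τ (t - a) := by
    intro t ht
    split_ifs with h'
    · rw [le_antisymm h' ht, h, sub_self]
    · rfl
  constructor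
  · intro s t hs hst ht
    rcases le_total t a with hta | hta
    · simp only [hta, hst.trans hta, if_true]
      exact hσ.join s t hs hst hta
    · rcases le_total s a with hsa | hsa
      · simp only [hval t hta, hsa, if_true]
        have h1 := hσ.join s a hs hsa le_rfl
        have h2 := hτ.join 0 (t - a) le_rfl (by linarith) (by linarith)
        rw [h] at h1
        convert h1.trans h2 using 1
        ring
      · simp only [hval t hta, hval s hsa]
        convert hτ.join (s - a) (t - a) (by linarith) (by linarith) (by linarith) using 1
        ring
  · intro s t hs hst ht r hr
    rcases le_total t a with hta | hta
    · simp only [hta, hst.trans hta, if_true]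
      refine hσ.edist_le s t hs hst hta r fun u hu => ?_
      simpa [hu.2.trans hta] using hr u hu
    · rcases le_total s a with hsa | hsa
      · simp only [hval t hta, hsa, if_true]
        have h1 := hσ.edist_le s a hs hsa le_rfl r fun u hu => by
          simpa [hu.2] using hr u ⟨hu.1, hu.2.trans hta⟩
        have h2 := hτ.edist_le 0 (t - a) le_rfl (by linarith) (by linarith) r fun u hu => by
          have := hr (u + a) ⟨by linarith [hu.1], by linarith [hu.2]⟩
          rw [hval _ (by linarith [hu.1])] at this
          simpa using this
        rw [h] at h1
        refine (edist_triangle _ (τ 0) _).trans ((add_le_add h1 h2).trans_eq ?_)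
        rw [← mul_add, ← ENNReal.ofReal_add (by linarith) (by linarith)]
        congr 2
        ring
      · simp only [hval t hta, hval s hsa]
        have h2 := hτ.edist_le (s - a) (t - a) (by linarith) (by linarith) (by linarith) r
          fun u hu => by
            have := hr (u + a) ⟨by linarith [hu.1], by linarith [hu.2]⟩
            rw [hval _ (by linarith [hu.1])] at this
            simpa using this
        convert h2 using 3
        ring

lemma ChainJoin.exists_isChainPath {x y : EuclideanSpace ℂ (Fin d)} {a : ℝ}
    (h : ChainJoin Ω x y a) : ∃ σ, IsChainPath Ω σ a ∧ σ 0 = x ∧ σ a = y := by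
  induction h with
  | refl hx =>
    refine ⟨_, isChainPath_disk (const_mem_holDisk hx) (u := 1) (by simp) 0, rfl, rfl⟩
  | @snoc a φ ζ η hφ hζ hη h ih =>
    obtain ⟨σ, hσ, h0, h1⟩ := ih
    obtain ⟨g, hg, hgm, u, hu, hg0, hg1⟩ := exists_geodesic_reparam hζ hη
    have hψ := HolDisk.comp hφ hg hgm
    have hj : σ a = (fun t : ℝ => (φ ∘ g) ((Real.tanh t : ℂ) * u)) 0 := by
      simp [h1, hg0]
    refine ⟨_, hσ.append (isChainPath_disk hψ hu (poincareDist ζ η)) hj, ?_, ?_⟩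
    · simp [h.nonneg, h0]
    · have hn := poincareDist_nonneg hζ hη
      -- If the last disk contributes length 0, the endpoint falls in the first branch of the
      -- concatenation.
      by_cases h' : a + poincareDist ζ η ≤ a
      · have h2 : poincareDist ζ η = 0 := by linarith
        simp only [h', if_true]
        rw [h2] at hg1
        rw [h2, add_zero, hj]
        exact congrArg φ hg1
      · simp only [h', if_false, add_sub_cancel_left, Function.comp, hg1]

end Paths

/-! ### Summability of the growth of the Kobayashi metric, and visibility -/

/-- A monotone function with `∫_0^ε G(r) / r dr < ∞` is summable along geometric sequences. -/
lemma tsum_geometric_ne_top_of_lintegral_div {G : ℝ → ℝ≥0∞} (hG : Monotone G) {ε s q : ℝ}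
    (hint : ∫⁻ r in Ioo (0 : ℝ) ε, G r / ENNReal.ofReal r < ∞) (hs : 0 < s) (hsε : s < ε)
    (hq : 0 < q) (hq1 : q < 1) : ∑' k : ℕ, G (s * q ^ (k + 1)) ≠ ⊤ := by
  set I : ℕ → Set ℝ := fun k => Ioc (s * q ^ (k + 1)) (s * q ^ k)
  have hanti : Antitone fun k : ℕ => s * q ^ k := fun m n h =>
    mul_le_mul_of_nonneg_left (pow_le_pow_of_le_one hq.le hq1.le h) hs.le
  have hdisj : Pairwise (Function.onFun Disjoint I) := by
    have := hanti.pairwise_disjoint_on_Ioc_succ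
    simpa using this
  have hsub : ⋃ k, I k ⊆ Ioo 0 ε := by
    refine iUnion_subset fun k x hx => ⟨lt_trans (by positivity) hx.1, hx.2.trans_lt ?_⟩
    calc s * q ^ k ≤ s * q ^ 0 := hanti (Nat.zero_le k)
      _ < ε := by simpa using hsε
  -- On the k-th interval, of length s q^k (1 - q), the integrand is at least G(s q^(k+1)) / (s
  -- q^k).
  have hterm : ∀ k, G (s * q ^ (k + 1)) * ENNReal.ofReal (1 - q)
      ≤ ∫⁻ r in I k, G r / ENNReal.ofReal r := by
    intro k
    have hpos : 0 < s * q ^ k := by positivity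
    calc G (s * q ^ (k + 1)) * ENNReal.ofReal (1 - q)
        = G (s * q ^ (k + 1)) / ENNReal.ofReal (s * q ^ k) * volume (I k) := by
          rw [Real.volume_Ioc, show s * q ^ k - s * q ^ (k + 1) = (s * q ^ k) * (1 - q) by ring,
            ENNReal.ofReal_mul hpos.le, ← mul_assoc, ENNReal.div_mul_cancel]
          · simpa using hpos
          · exact ENNReal.ofReal_ne_top
      _ = ∫⁻ _ in I k, G (s * q ^ (k + 1)) / ENNReal.ofReal (s * q ^ k) := by
          rw [setLIntegral_const]
      _ ≤ _ := setLIntegral_mono' measurableSet_Ioc fun r hr =>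
          ENNReal.div_le_div (hG hr.1.le) (ENNReal.ofReal_le_ofReal hr.2)
  have hsum : (∑' k : ℕ, G (s * q ^ (k + 1))) * ENNReal.ofReal (1 - q) < ⊤ := by
    rw [← ENNReal.tsum_mul_right]
    calc _ ≤ ∑' k, ∫⁻ r in I k, G r / ENNReal.ofReal r := ENNReal.tsum_le_tsum hterm
      _ = ∫⁻ r in ⋃ k, I k, G r / ENNReal.ofReal r :=
          (lintegral_iUnion (fun _ => measurableSet_Ioc) hdisj _).symm
      _ ≤ _ := lintegral_mono_set hsub
      _ < ⊤ := hint
  intro h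
  rw [h, ENNReal.top_mul (by simpa using hq1)] at hsum
  exact lt_irrefl _ hsum

lemma exists_pos_lt_of_lintegral_div {G : ℝ → ℝ≥0∞} (hG : Monotone G) {ε : ℝ} (hε : 0 < ε)
    (hint : ∫⁻ r in Ioo (0 : ℝ) ε, G r / ENNReal.ofReal r < ∞) {η : ℝ≥0∞} (hη : 0 < η) :
    ∃ r > 0, G r < η := by
  have h := tsum_geometric_ne_top_of_lintegral_div hG hint (half_pos hε) (half_lt_self hε)
    (q := 1 / 2) (by norm_num) (by norm_num)
  have h1 := ENNReal.tendsto_atTop_zero_of_tsum_ne_top h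
  obtain ⟨k, hk⟩ := (h1.eventually (gt_mem_nhds hη)).exists
  exact ⟨_, by positivity, hk⟩

/-- The tail of the series is small whatever `r` is, by comparison with a convergent geometric
sampling of `G`; the finitely many remaining terms are each at most `G r`, which is small for a
suitable `r`. -/
lemma exists_pos_tsum_min_le {G : ℝ → ℝ≥0∞} (hG : Monotone G) {ε B q : ℝ} (hε : 0 < ε)
    (hint : ∫⁻ r in Ioo (0 : ℝ) ε, G r / ENNReal.ofReal r < ∞)
    (hq : 0 < q) (hq1 : q < 1) {η : ℝ≥0∞} (hη : 0 < η) :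
    ∃ r > 0, ∑' k : ℕ, G (min r (B * q ^ k)) ≤ η := by
  have hη2 : 0 < η / 2 := ENNReal.half_pos hη.ne'
  have hsum := tsum_geometric_ne_top_of_lintegral_div hG hint (half_pos hε) (half_lt_self hε)
    hq hq1
  obtain ⟨J, hJ⟩ := ((ENNReal.tendsto_sum_nat_add _ hsum).eventually (gt_mem_nhds hη2)).exists
  obtain ⟨N, hN⟩ : ∃ N : ℕ, B * q ^ N ≤ ε / 2 := by
    have : Tendsto (fun N : ℕ => B * q ^ N) atTop (𝓝 (B * 0)) :=
      (tendsto_pow_atTop_nhds_zero_of_lt_one hq.le hq1).const_mul B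
    rw [mul_zero] at this
    exact ((this.eventually (gt_mem_nhds (half_pos hε))).exists).imp fun _ h => le_of_lt h
  -- `N` steps absorb the factor `B` into ε/2; `J + 1` steps reach the small tail.
  set n := J + 1 + N with hn
  obtain ⟨r, hr, hGr⟩ := exists_pos_lt_of_lintegral_div hG hε hint
    (ENNReal.div_pos hη2.ne' (ENNReal.natCast_ne_top n))
  refine ⟨r, hr, ?_⟩
  rw [← Summable.sum_add_tsum_nat_add' (k := n) ENNReal.summable]
  calc _ ≤ ∑ _k ∈ Finset.range n, G r + ∑' j : ℕ, G (ε / 2 * q ^ (j + J + 1)) := by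
        gcongr with k _ j
        · exact hG (min_le_left _ _)
        · refine hG ((min_le_right _ _).trans ?_)
          calc B * q ^ (j + n) = B * q ^ N * q ^ (j + J + 1) := by rw [hn]; ring
            _ ≤ _ := by gcongr
    _ ≤ η / 2 + η / 2 := by
        gcongr
        rw [Finset.sum_const, Finset.card_range, nsmul_eq_mul]
        calc (n : ℝ≥0∞) * G r ≤ n * (η / 2 / n) := by gcongr
          _ ≤ η / 2 := ENNReal.mul_div_le
    _ = η := ENNReal.add_halves η

section Visibility

variable {d : ℕ} {Ω : Set (EuclideanSpace ℂ (Fin d))}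

lemma kobayashiGrowth_mono : Monotone (kobayashiGrowth Ω) := by
  intro r s hrs
  unfold kobayashiGrowth
  refine iSup₂_mono fun x hx => iSup_mono' fun h => ⟨h.trans hrs, le_rfl⟩

/-- A path that approaches the boundary with a prescribed speed has small displacement. -/
lemma edist_le_tsum_kobayashiGrowth {τ : ℝ → EuclideanSpace ℂ (Fin d)} {T : ℝ} {g : ℕ → ℝ}
    (hτ : ∀ s t, 0 ≤ s → s ≤ t → t ≤ T → ∀ r, (∀ u ∈ Icc s t, boundaryDist Ω (τ u) ≤ r) →
      edist (τ s) (τ t) ≤ kobayashiGrowth Ω r * ENNReal.ofReal (t - s))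
    (hg : ∀ k : ℕ, ∀ u, (k : ℝ) ≤ u → u ≤ T → boundaryDist Ω (τ u) ≤ g k)
    {t : ℝ} (h0 : 0 ≤ t) (hT : t ≤ T) :
    edist (τ 0) (τ t) ≤ ∑' k, kobayashiGrowth Ω (g k) := by
  have key : ∀ n : ℕ, ∀ t, 0 ≤ t → t ≤ T → t ≤ n →
      edist (τ 0) (τ t) ≤ ∑ k ∈ Finset.range n, kobayashiGrowth Ω (g k) := by
    intro n
    induction n with
    | zero =>
      intro t h0 _ h1
      have : t = 0 := le_antisymm (by simpa using h1) h0
      simp [this]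
    | succ n ih =>
      intro t h0 hT h1
      rw [Finset.sum_range_succ]
      rcases le_total t n with h | h
      · exact (ih t h0 hT h).trans le_self_add
      · refine (edist_triangle _ (τ n) _).trans
          (add_le_add (ih n (Nat.cast_nonneg n) (h.trans hT) le_rfl) ?_)
        refine (hτ n t (Nat.cast_nonneg n) h hT (g n) fun u hu => hg n u hu.1 (hu.2.trans hT)).trans
          ?_
        refine mul_le_of_le_one_right' (ENNReal.ofReal_le_one.2 ?_)
        push_cast at h1
        linarith
  obtain ⟨n, hn⟩ := exists_nat_ge t
  exact (key n t h0 hT hn).trans (ENNReal.sum_le_tsum _)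

/-- **Visibility** of Goldilocks domains: points which are far apart for the Euclidean distance are
joined, up to an arbitrarily small error, through a fixed compact part of the domain. -/
theorem IsGoldilocksDomain.visibility (hΩ : IsGoldilocksDomain Ω) {ε : ℝ} (hε : 0 < ε) :
    ∃ r > 0, ∀ p ∈ Ω, ∀ q ∈ Ω, ε ≤ dist p q → ∀ κ > 0, ∃ k ∈ Ω, r ≤ boundaryDist Ω k ∧
      kobayashiDist Ω p k + kobayashiDist Ω k q ≤ kobayashiDist Ω p q + κ := by
  have hc := hΩ.isConnected.isPreconnected
  obtain ⟨o, ho⟩ := hΩ.isConnected.nonempty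
  obtain ⟨C, -, α, hα, hK⟩ := hΩ.dist_growth o ho
  obtain ⟨ε₀, hε₀, hint⟩ := hΩ.metric_growth
  -- Solving k ≤ 2C + 2 - 2α log δ for δ gives δ ≤ B Q^k.
  set Q := Real.exp (-(1 / (2 * α))) with hQ
  set B := Real.exp ((2 * C + 2) / (2 * α)) with hB
  obtain ⟨r, hr, hsum⟩ := exists_pos_tsum_min_le (kobayashiGrowth_mono (Ω := Ω)) hε₀ hint
    (B := B) (Real.exp_pos (-(1 / (2 * α))))
    (Real.exp_lt_one_iff.2 (by simpa using hα)) (η := ENNReal.ofReal (ε / 3)) (by simpa using hε)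
  refine ⟨r, hr, fun p hp q hq hpq κ hκ => ?_⟩
  by_contra! hcon
  -- Excess below κ keeps the path within distance `r` of the boundary, for otherwise one of its
  -- points would serve as k; excess below 1 makes it geodesic up to an additive error 1.
  obtain ⟨a, ha, hj⟩ := exists_chainJoin_lt hΩ.isOpen hc hp hq
    (show kobayashiDist Ω p q < kobayashiDist Ω p q + min κ 1 by
      linarith [show 0 < min κ 1 by positivity])
  obtain ⟨σ, hσ, rfl, rfl⟩ := hj.exists_isChainPath
  have ha0 := hj.nonneg
  have hmem : ∀ t, 0 ≤ t → t ≤ a → σ t ∈ Ω := fun t h0 h1 => (hσ.join 0 t le_rfl h0 h1).right_mem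
  have hlt : ∀ t, 0 ≤ t → t ≤ a → boundaryDist Ω (σ t) ≤ r := by
    intro t h0 h1
    by_contra! h
    have := hcon _ (hmem t h0 h1) h.le
    have h2 := (hσ.join 0 t le_rfl h0 h1).kobayashiDist_le
    have h3 := (hσ.join t a h0 h1 le_rfl).kobayashiDist_le
    linarith [min_le_left κ 1]
  have hquasi : ∀ s t, 0 ≤ s → s ≤ t → t ≤ a → t - s ≤ kobayashiDist Ω (σ s) (σ t) + 1 := by
    intro s t hs hst ht
    have h1 := (hσ.join 0 s le_rfl hs (hst.trans ht)).kobayashiDist_le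
    have h2 := (hσ.join t a (hs.trans hst) ht le_rfl).kobayashiDist_le
    have h3 := kobayashiDist_triangle hΩ.isOpen hc hp (hmem s hs (hst.trans ht)) hq
    have h4 := kobayashiDist_triangle hΩ.isOpen hc (hmem s hs (hst.trans ht))
      (hmem t (hs.trans hst) ht) hq
    linarith [min_le_right κ 1]
  -- An almost nearest point to `o`; an error of 1 is harmless, so the minimum need not be attained.
  obtain ⟨t₀, ⟨h0, h1⟩, hmin⟩ : ∃ t₀ ∈ Icc 0 a, ∀ t ∈ Icc 0 a,
      kobayashiDist Ω o (σ t₀) ≤ kobayashiDist Ω o (σ t) + 1 := by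
    have hne : ((fun t => kobayashiDist Ω o (σ t)) '' Icc 0 a).Nonempty :=
      ⟨_, 0, ⟨le_rfl, ha0⟩, rfl⟩
    have hbdd : BddBelow ((fun t => kobayashiDist Ω o (σ t)) '' Icc 0 a) := by
      refine ⟨0, ?_⟩
      rintro _ ⟨t, -, rfl⟩
      exact kobayashiDist_nonneg
    obtain ⟨_, ⟨t₀, ht₀, rfl⟩, hlt⟩ := exists_lt_of_csInf_lt hne (lt_add_one _)
    refine ⟨t₀, ht₀, fun t ht => hlt.le.trans ?_⟩
    gcongr
    exact csInf_le hbdd ⟨t, ht, rfl⟩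
  have hdecay : ∀ t, 0 ≤ t → t ≤ a → ∀ k : ℕ, (k : ℝ) ≤ |t - t₀| →
      boundaryDist Ω (σ t) ≤ min r (B * Q ^ k) := by
    intro t ht hta k hk
    refine le_min (hlt t ht hta) ?_
    rcases le_or_gt (boundaryDist Ω (σ t)) 0 with hδ | hδ
    · exact hδ.trans (by positivity)
    -- By the triangle inequality through `o` and the choice of `t₀`, |t - t₀| ≤ 2 K(o, σ t) + 2, to
    -- which the growth bound applies.
    have h2 : |t - t₀| ≤ kobayashiDist Ω (σ t) (σ t₀) + 1 := by
      rcases le_total t t₀ with h | h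
      · rw [abs_of_nonpos (by linarith)]
        linarith [hquasi t t₀ ht h h1]
      · rw [abs_of_nonneg (by linarith), kobayashiDist_comm]
        exact hquasi t₀ t h0 h hta
    have h3 := kobayashiDist_triangle hΩ.isOpen hc (hmem t ht hta) ho (hmem t₀ h0 h1)
    rw [kobayashiDist_comm (σ t) o] at h3
    have h4 := hmin t ⟨ht, hta⟩
    have h5 := hK _ (hmem t ht hta)
    rw [one_div, Real.log_inv] at h5
    have h6 : (k : ℝ) ≤ 2 * C + 2 - 2 * α * Real.log (boundaryDist Ω (σ t)) := by linarith
    rw [← Real.exp_log hδ, hB, hQ, ← Real.exp_nat_mul, ← Real.exp_add, Real.exp_le_exp,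
      show (2 * C + 2) / (2 * α) + k * -(1 / (2 * α)) = (2 * C + 2 - k) / (2 * α) by ring,
      le_div_iff₀ (by positivity)]
    linarith
  have hright : edist (σ t₀) (σ a) ≤ ENNReal.ofReal (ε / 3) := by
    have := edist_le_tsum_kobayashiGrowth (Ω := Ω) (τ := fun u => σ (t₀ + u)) (T := a - t₀)
      (g := fun k => min r (B * Q ^ k)) ?_ ?_ (sub_nonneg.2 h1) le_rfl
    · simpa using this.trans hsum
    · intro s t hs hst ht r' hr'
      have := hσ.edist_le (t₀ + s) (t₀ + t) (by linarith) (by linarith) (by linarith) r'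
        fun u hu => by
          simpa using hr' (u - t₀) ⟨by linarith [hu.1], by linarith [hu.2]⟩
      simpa using this
    · intro k u hk hu
      have : (0 : ℝ) ≤ k := Nat.cast_nonneg k
      refine hdecay _ (by linarith) (by linarith) k ?_
      simpa using hk.trans (le_abs_self u)
  have hleft : edist (σ t₀) (σ 0) ≤ ENNReal.ofReal (ε / 3) := by
    have := edist_le_tsum_kobayashiGrowth (Ω := Ω) (τ := fun u => σ (t₀ - u)) (T := t₀)
      (g := fun k => min r (B * Q ^ k)) ?_ ?_ h0 le_rfl
    · simpa using this.trans hsum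
    · intro s t hs hst ht r' hr'
      have := hσ.edist_le (t₀ - t) (t₀ - s) (by linarith) (by linarith) (by linarith) r'
        fun u hu => by
          simpa using hr' (t₀ - u) ⟨by linarith [hu.2], by linarith [hu.1]⟩
      rw [edist_comm]
      simpa using this
    · intro k u hk hu
      have : (0 : ℝ) ≤ k := Nat.cast_nonneg k
      refine hdecay _ (by linarith) (by linarith) k ?_
      rw [sub_sub_cancel_left, abs_neg]
      exact hk.trans (le_abs_self u)
  have hfin : edist (σ 0) (σ a) ≤ ENNReal.ofReal (ε / 3 + ε / 3) := by
    rw [ENNReal.ofReal_add (by positivity) (by positivity)]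
    exact (edist_triangle_left _ _ (σ t₀)).trans (add_le_add hleft hright)
  rw [edist_dist, ENNReal.ofReal_le_ofReal_iff (by positivity)] at hfin
  linarith

end Visibility

/-! ### Iteration: recurrent orbits -/

section Iteration

variable {d : ℕ} {Ω : Set (EuclideanSpace ℂ (Fin d))}
  {f : EuclideanSpace ℂ (Fin d) → EuclideanSpace ℂ (Fin d)} {x y o : EuclideanSpace ℂ (Fin d)}

lemma kobayashiDist_iterate_le (hΩ : IsOpen Ω) (hc : IsPreconnected Ω)
    (hf : DifferentiableOn ℂ f Ω) (hm : MapsTo f Ω Ω) (n : ℕ) (hx : x ∈ Ω) (hy : y ∈ Ω) :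
    kobayashiDist Ω (f^[n] x) (f^[n] y) ≤ kobayashiDist Ω x y :=
  kobayashiDist_map_le hΩ hc (hf.iterate hm n) (hm.iterate n) hx hy

/-- Equicontinuity of the iterates: they do not increase K, which dominates the Euclidean distance
up to a factor. -/
lemma eventually_forall_dist_iterate_lt (hΩ : IsOpen Ω) (hc : IsPreconnected Ω)
    (hb : Bornology.IsBounded Ω) (hf : DifferentiableOn ℂ f Ω) (hm : MapsTo f Ω Ω)
    (hx : x ∈ Ω) {ε : ℝ} (hε : 0 < ε) :
    ∀ᶠ y in 𝓝 x, ∀ n : ℕ, dist (f^[n] x) (f^[n] y) < ε := by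
  obtain ⟨D, hD, hdist⟩ := exists_dist_le_mul_kobayashiDist hΩ hc hb
  filter_upwards [eventually_kobayashiDist_lt hΩ hx (div_pos hε hD)] with y ⟨hy, hxy⟩ n
  calc dist (f^[n] x) (f^[n] y) ≤ D * kobayashiDist Ω (f^[n] x) (f^[n] y) :=
        hdist _ (hm.iterate n hx) _ (hm.iterate n hy)
    _ ≤ D * kobayashiDist Ω x y := by
        gcongr
        exact kobayashiDist_iterate_le hΩ hc hf hm n hx hy
    _ < D * (ε / D) := by gcongr
    _ = ε := mul_div_cancel₀ _ hD.ne'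

/-- The orbit of a recurrent point stays in a compact set. -/
lemma exists_isCompact_of_recurrent (hΩ : IsOpen Ω) (hc : IsPreconnected Ω)
    (hb : Bornology.IsBounded Ω) (hf : DifferentiableOn ℂ f Ω) (hm : MapsTo f Ω Ω) (hy : y ∈ Ω)
    (hrec : ∀ ε > 0, ∀ N, ∃ k ≥ N, kobayashiDist Ω (f^[k] y) y < ε) :
    ∃ L, IsCompact L ∧ L ⊆ Ω ∧ ∀ n, f^[n] y ∈ L := by
  obtain ⟨D, hD, hdist⟩ := exists_dist_le_mul_kobayashiDist hΩ hc hb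
  obtain ⟨s, hs, hsub⟩ := Metric.nhds_basis_closedBall.mem_iff.1 (hΩ.mem_nhds hy)
  have horb : ∀ n, f^[n] y ∈ Ω := fun n => hm.iterate n hy
  set ε := s / D
  have hε : 0 < ε := div_pos hs hD
  have hball : ∀ n, kobayashiDist Ω (f^[n] y) y < ε → f^[n] y ∈ closedBall y s := by
    intro n hn
    refine mem_closedBall.2 ((hdist _ (horb n) _ hy).trans ?_)
    calc D * kobayashiDist Ω (f^[n] y) y ≤ D * ε := by gcongr
      _ = s := mul_div_cancel₀ _ hD.ne'
  -- By compactness, every visit near `y` is close to one of the finitely many points f^j(y) with j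
  -- ≤ M.
  obtain ⟨M, hM⟩ : ∃ M : ℕ, ∀ n, kobayashiDist Ω (f^[n] y) y < ε →
      ∃ j ≤ M, kobayashiDist Ω (f^[n] y) (f^[j] y) < ε / 2 := by
    obtain ⟨t, ht, hcov⟩ := (isCompact_closedBall y s).elim_nhds_subcover
      (fun z => {w | w ∈ Ω ∧ kobayashiDist Ω z w < ε / 4})
      (fun z hz => eventually_kobayashiDist_lt hΩ (hsub hz) (by positivity))
    have hj : ∀ z, ∃ j : ℕ, (∃ i, f^[i] y ∈ {w | w ∈ Ω ∧ kobayashiDist Ω z w < ε / 4}) →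
        f^[j] y ∈ {w | w ∈ Ω ∧ kobayashiDist Ω z w < ε / 4} := by
      intro z
      by_cases h : ∃ i, f^[i] y ∈ {w | w ∈ Ω ∧ kobayashiDist Ω z w < ε / 4}
      · exact h.imp fun i hi _ => hi
      · exact ⟨0, fun h' => absurd h' h⟩
    choose j hj using hj
    refine ⟨t.sup j, fun n hn => ?_⟩
    obtain ⟨z, hz, hnz⟩ := mem_iUnion₂.1 (hcov (hball n hn))
    refine ⟨j z, Finset.le_sup hz, ?_⟩
    have h1 := (hj z ⟨n, hnz⟩).2
    have h2 := hnz.2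
    have h3 := kobayashiDist_triangle hΩ hc (horb n) (hsub (ht z hz)) (horb (j z))
    rw [kobayashiDist_comm (f^[n] y) z] at h3
    linarith
  -- A return time k > M. A visit at time n, close to f^j(y), is followed by one at time n + (k -
  -- j), since f^(k-j) sends f^j(y) to f^k(y), near `y`. The gap lies between 1 and k.
  obtain ⟨k, hk, hky⟩ := hrec (ε / 2) (by positivity) (M + 1)
  have hreturn : ∀ n, kobayashiDist Ω (f^[n] y) y < ε →
      ∃ j ≤ M, kobayashiDist Ω (f^[n + (k - j)] y) y < ε := by
    intro n hn
    obtain ⟨j, hj, hnj⟩ := hM n hn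
    refine ⟨j, hj, ?_⟩
    have h1 := kobayashiDist_iterate_le hΩ hc hf hm (k - j) (horb n) (horb j)
    rw [← Function.iterate_add_apply, ← Function.iterate_add_apply, Nat.sub_add_cancel (by omega),
      add_comm] at h1
    have h2 := kobayashiDist_triangle hΩ hc (horb (n + (k - j))) (horb k) hy
    linarith
  have hgap : ∀ n, ∃ i ≤ k, ∃ m, kobayashiDist Ω (f^[m] y) y < ε ∧ n = i + m := by
    intro n
    induction n with
    | zero => exact ⟨0, Nat.zero_le _, 0, by simpa [kobayashiDist_self hy] using hε, rfl⟩
    | succ n ih =>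
      obtain ⟨i, hi, m, hm', rfl⟩ := ih
      rcases hi.eq_or_lt with rfl | hlt
      · obtain ⟨j, hj, hj'⟩ := hreturn m hm'
        exact ⟨j + 1, by omega, _, hj', by omega⟩
      · exact ⟨i + 1, hlt, m, hm', by omega⟩
  refine ⟨⋃ i ∈ Iic k, f^[i] '' closedBall y s, (finite_Iic k).isCompact_biUnion fun i _ =>
    (isCompact_closedBall y s).image_of_continuousOn
      ((hf.iterate hm i).continuousOn.mono hsub), ?_, fun n => ?_⟩
  · exact iUnion₂_subset fun i _ => (image_mono hsub).trans (hm.iterate i).image_subset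
  · obtain ⟨i, hi, m, hm', rfl⟩ := hgap n
    rw [Function.iterate_add_apply]
    exact mem_biUnion (mem_Iic.2 hi) (mem_image_of_mem _ (hball m hm'))

/-- If f^n(x) and f^m(x) are both close to y with m > n, then f^(m-n)(y) is close to f^m(x), hence
to y. -/
lemma recurrent_of_mapClusterPt (hΩ : IsOpen Ω) (hc : IsPreconnected Ω)
    (hf : DifferentiableOn ℂ f Ω) (hm : MapsTo f Ω Ω) (hx : x ∈ Ω) (hy : y ∈ Ω)
    (hxy : MapClusterPt y atTop fun n : ℕ => f^[n] x) :
    ∀ ε > 0, ∀ N, ∃ k ≥ N, kobayashiDist Ω (f^[k] y) y < ε := by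
  intro ε hε N
  have hfr := hxy.frequently (eventually_kobayashiDist_lt hΩ hy (half_pos hε))
  obtain ⟨n, hn⟩ := hfr.exists
  obtain ⟨m, hmn, hm'⟩ := (frequently_atTop.1 hfr) (n + N)
  refine ⟨m - n, by omega, ?_⟩
  have h1 := kobayashiDist_iterate_le hΩ hc hf hm (m - n) hy (hm.iterate n hx)
  rw [← Function.iterate_add_apply, Nat.sub_add_cancel (by omega)] at h1
  have h2 := kobayashiDist_triangle hΩ hc (hm.iterate (m - n) hy) (hm.iterate m hx) hy
  rw [kobayashiDist_comm (f^[m] x) y] at h2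
  linarith [hn.2, hm'.2]

/-- In a taut domain, relative compactness of orbits propagates along chains of disks. -/
lemma IsTaut.exists_isCompact_of_chainJoin (htaut : IsTaut Ω) (hb : Bornology.IsBounded Ω)
    (hf : DifferentiableOn ℂ f Ω) (hm : MapsTo f Ω Ω) {a : ℝ} (h : ChainJoin Ω x y a)
    (hx : ∃ L, IsCompact L ∧ L ⊆ Ω ∧ ∀ n, f^[n] x ∈ L) :
    ∃ L, IsCompact L ∧ L ⊆ Ω ∧ ∀ n, f^[n] y ∈ L := by
  induction h with
  | refl => exact hx
  | @snoc a φ ζ η hφ hζ hη h ih =>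
    obtain ⟨L, hL, hLΩ, hmem⟩ := ih
    have hrange : range (fun n : ℕ => f^[n] (φ η)) ⊆ Ω := by
      rintro _ ⟨n, rfl⟩
      exact hm.iterate n (hφ.2 hη)
    refine ⟨closure (range fun n : ℕ => f^[n] (φ η)), (hb.subset hrange).isCompact_closure, ?_,
      fun n => subset_closure ⟨n, rfl⟩⟩
    intro z hz
    obtain ⟨w, hw, hwz⟩ := mem_closure_iff_seq_limit.1 hz
    choose n hn using hw
    -- The disks f^(n j) ∘ φ cannot diverge compactly, since their values at `ζ` stay in `L`; a
    -- limit disk takes the value `z` at `η`, so `z` lies in Ω.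
    obtain ⟨s, hs, ⟨ψ, hψ, hlim⟩ | hdiv⟩ := htaut (fun j => f^[n j] ∘ φ)
      fun j => HolDisk.map hφ (hf.iterate hm (n j)) (hm.iterate (n j))
    · have h1 : Tendsto (fun j => (f^[n (s j)] ∘ φ) η) atTop (𝓝 (ψ η)) := hlim.tendsto_at hη
      have h2 : Tendsto (fun j => (f^[n (s j)] ∘ φ) η) atTop (𝓝 z) := by
        have : (fun j => (f^[n (s j)] ∘ φ) η) = fun j => w (s j) := by
          ext1 j
          exact hn (s j)
        rw [this]
        exact hwz.comp hs.tendsto_atTop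
      rw [tendsto_nhds_unique h2 h1]
      exact hψ.2 hη
    · obtain ⟨j, hj⟩ := (hdiv {ζ} isCompact_singleton (by simpa using hζ) L hL hLΩ).exists
      refine absurd (hmem (n (s j))) ?_
      simpa using hj

lemma IsGoldilocksDomain.isCompact_closure_orbit (hΩ : IsGoldilocksDomain Ω) (htaut : IsTaut Ω)
    (hf : DifferentiableOn ℂ f Ω) (hm : MapsTo f Ω Ω) (ho : o ∈ Ω) (hy : y ∈ Ω)
    (hoy : MapClusterPt y atTop fun n : ℕ => f^[n] o) (hx : x ∈ Ω) :
    IsCompact (closure (range fun n : ℕ => f^[n] x)) ∧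
      closure (range fun n : ℕ => f^[n] x) ⊆ Ω := by
  have hc := hΩ.isConnected.isPreconnected
  obtain ⟨a, ha⟩ := exists_chainJoin hΩ.isOpen hc hy hx
  obtain ⟨L, hL, hLΩ, hmem⟩ := htaut.exists_isCompact_of_chainJoin hΩ.isBounded hf hm ha
    (exists_isCompact_of_recurrent hΩ.isOpen hc hΩ.isBounded hf hm hy
      (recurrent_of_mapClusterPt hΩ.isOpen hc hf hm ho hy hoy))
  have hsub : closure (range fun n : ℕ => f^[n] x) ⊆ L :=
    closure_minimal (range_subset_iff.2 hmem) hL.isClosed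
  exact ⟨hL.of_isClosed_subset isClosed_closure hsub, hsub.trans hLΩ⟩

end Iteration

/-! ### Iteration: compactly divergent orbits -/

section Divergence

variable {d : ℕ} {Ω : Set (EuclideanSpace ℂ (Fin d))}
  {f : EuclideanSpace ℂ (Fin d) → EuclideanSpace ℂ (Fin d)}
  {x y o ξ η : EuclideanSpace ℂ (Fin d)}

lemma boundaryDist_le_add_dist (x y : EuclideanSpace ℂ (Fin d)) :
    boundaryDist Ω x ≤ boundaryDist Ω y + dist x y :=
  infDist_le_infDist_add_dist

lemma isCompact_setOf_le_boundaryDist (hΩ : IsOpen Ω) (hb : Bornology.IsBounded Ω) {r : ℝ}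
    (hr : 0 < r) : IsCompact {x | x ∈ Ω ∧ r ≤ boundaryDist Ω x} := by
  have : {x | x ∈ Ω ∧ r ≤ boundaryDist Ω x} = closure Ω ∩ {x | r ≤ boundaryDist Ω x} := by
    ext x
    refine ⟨fun h => ⟨subset_closure h.1, h.2⟩, fun h => ⟨?_, h.2⟩⟩
    by_contra hx
    have hfr : x ∈ frontier Ω := by
      rw [hΩ.frontier_eq]
      exact ⟨h.1, hx⟩
    have h2 : r ≤ boundaryDist Ω x := h.2
    rw [boundaryDist, infDist_zero_of_mem hfr] at h2
    linarith
  rw [this]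
  exact hb.isCompact_closure.inter_right
    (isClosed_le continuous_const (continuous_infDist_pt _))

lemma eventually_forall_mem_of_isCompact {A : Set (EuclideanSpace ℂ (Fin d))} (hA : IsCompact A)
    {P : ℕ → EuclideanSpace ℂ (Fin d) → Prop}
    (hP : ∀ x ∈ A, ∃ U ∈ 𝓝 x, ∀ᶠ n in atTop, ∀ y ∈ U, P n y) :
    ∀ᶠ n in atTop, ∀ x ∈ A, P n x := by
  refine hA.induction_on (p := fun s => ∀ᶠ n in atTop, ∀ x ∈ s, P n x) (by simp) ?_ ?_ ?_
  · exact fun s t hst ht => ht.mono fun n hn x hx => hn x (hst hx)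
  · intro s t hs ht
    filter_upwards [hs, ht] with n h1 h2 x hx
    exact hx.elim (h1 x) (h2 x)
  · intro x hx
    obtain ⟨U, hU, h⟩ := hP x hx
    exact ⟨U, mem_nhdsWithin_of_mem_nhds hU, h⟩

/-- If orbits have no cluster point in the domain, they approach the boundary, uniformly on
compact sets of starting points. -/
lemma eventually_forall_boundaryDist_lt (hΩ : IsOpen Ω) (hc : IsPreconnected Ω)
    (hb : Bornology.IsBounded Ω) (hf : DifferentiableOn ℂ f Ω) (hm : MapsTo f Ω Ω)
    (hdiv : ∀ x ∈ Ω, ∀ y ∈ Ω, ¬ MapClusterPt y atTop fun n : ℕ => f^[n] x)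
    {A : Set (EuclideanSpace ℂ (Fin d))} (hA : IsCompact A) (hAΩ : A ⊆ Ω) {r : ℝ} (hr : 0 < r) :
    ∀ᶠ n in atTop, ∀ x ∈ A, boundaryDist Ω (f^[n] x) < r := by
  refine eventually_forall_mem_of_isCompact hA fun x hx => ?_
  refine ⟨_, eventually_forall_dist_iterate_lt hΩ hc hb hf hm (hAΩ hx) (half_pos hr), ?_⟩
  have hpt : ∀ᶠ n in atTop, boundaryDist Ω (f^[n] x) < r / 2 := by
    by_contra hcon
    rw [not_eventually] at hcon
    obtain ⟨y, hy, hcl⟩ := (isCompact_setOf_le_boundaryDist hΩ hb (half_pos hr)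
      ).exists_mapClusterPt_of_frequently (f := fun n : ℕ => f^[n] x)
        (hcon.mono fun n hn => ⟨hm.iterate n (hAΩ hx), not_lt.1 hn⟩)
    exact hdiv x (hAΩ hx) y hy.1 hcl
  filter_upwards [hpt] with n hn y hy
  have h1 : dist (f^[n] x) (f^[n] y) < r / 2 := hy n
  have h2 := boundaryDist_le_add_dist (Ω := Ω) (f^[n] y) (f^[n] x)
  rw [dist_comm] at h2
  linarith

/-- If orbits have no cluster point in the domain, they are asymptotic to each other. -/
lemma tendsto_edist_iterate (hΩ : IsGoldilocksDomain Ω) (hf : DifferentiableOn ℂ f Ω)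
    (hm : MapsTo f Ω Ω) (hdiv : ∀ x ∈ Ω, ∀ y ∈ Ω, ¬ MapClusterPt y atTop fun n : ℕ => f^[n] x)
    (hx : x ∈ Ω) (hy : y ∈ Ω) :
    Tendsto (fun n : ℕ => edist (f^[n] x) (f^[n] y)) atTop (𝓝 0) := by
  have hc := hΩ.isConnected.isPreconnected
  obtain ⟨a, ha⟩ := exists_chainJoin hΩ.isOpen hc hx hy
  obtain ⟨ε₀, hε₀, hint⟩ := hΩ.metric_growth
  clear hy
  induction ha with
  | refl => simp
  | @snoc a φ ζ η hφ hζ hη h ih =>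
    suffices hsuff : Tendsto (fun n : ℕ => edist (f^[n] (φ ζ)) (f^[n] (φ η))) atTop (𝓝 0) by
      have hadd := ih.add hsuff
      rw [add_zero] at hadd
      exact tendsto_of_tendsto_of_tendsto_of_le_of_le tendsto_const_nhds hadd
        (fun _ => zero_le) fun n => edist_triangle _ _ _
    obtain ⟨g, hg, hgm, u, hu, hg0, hg1⟩ := exists_geodesic_reparam hζ hη
    have hψ := HolDisk.comp hφ hg hgm
    set ℓ := poincareDist ζ η
    have hℓ : 0 ≤ ℓ := poincareDist_nonneg hζ hη
    have hcont : ContinuousOn (fun t : ℝ => (φ ∘ g) ((Real.tanh t : ℂ) * u)) (Icc 0 ℓ) := by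
      refine hψ.1.continuousOn.comp ?_ fun t _ => tanh_mul_mem_ball hu t
      have h1 : Continuous Real.tanh :=
        continuous_iff_continuousAt.2 fun t => (Real.hasDerivAt_tanh' t).continuousAt
      exact ((Complex.continuous_ofReal.comp h1).mul continuous_const).continuousOn
    have hA := isCompact_Icc.image_of_continuousOn hcont
    have hAΩ : (fun t : ℝ => (φ ∘ g) ((Real.tanh t : ℂ) * u)) '' Icc 0 ℓ ⊆ Ω := by
      rintro _ ⟨t, _, rfl⟩
      exact hψ.2 (tanh_mul_mem_ball hu t)
    rw [ENNReal.tendsto_nhds_zero]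
    intro ε hε
    -- Once the image of the arc lies within `r` of the boundary, its Euclidean length is at most
    -- M(r) ℓ, below ε by this choice.
    obtain ⟨r, hr, hGr⟩ := exists_pos_lt_of_lintegral_div (kobayashiGrowth_mono (Ω := Ω)) hε₀ hint
      (ENNReal.div_pos hε.ne' (ENNReal.ofReal_ne_top (r := ℓ)))
    filter_upwards [eventually_forall_boundaryDist_lt hΩ.isOpen hc hΩ.isBounded hf hm hdiv hA hAΩ
      hr] with n hn
    have hp := isChainPath_disk (HolDisk.map hψ (hf.iterate hm n) (hm.iterate n)) hu ℓ
    have h1 := hp.edist_le 0 ℓ le_rfl hℓ le_rfl r fun t ht => (hn _ ⟨t, ht, rfl⟩).le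
    simp only [Function.comp, hg1, Real.tanh_zero, Complex.ofReal_zero, zero_mul, hg0,
      sub_zero] at h1
    refine h1.trans ((mul_le_mul_left hGr.le _).trans ?_)
    rw [mul_comm]
    exact ENNReal.mul_div_le

lemma eventually_forall_dist_iterate_lt_of_isCompact (hΩ : IsGoldilocksDomain Ω)
    (hf : DifferentiableOn ℂ f Ω) (hm : MapsTo f Ω Ω)
    (hdiv : ∀ x ∈ Ω, ∀ y ∈ Ω, ¬ MapClusterPt y atTop fun n : ℕ => f^[n] x) (ho : o ∈ Ω)
    {A : Set (EuclideanSpace ℂ (Fin d))} (hA : IsCompact A) (hAΩ : A ⊆ Ω) {ε : ℝ} (hε : 0 < ε) :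
    ∀ᶠ n in atTop, ∀ x ∈ A, dist (f^[n] x) (f^[n] o) < ε := by
  refine eventually_forall_mem_of_isCompact hA fun x hx => ?_
  refine ⟨_, eventually_forall_dist_iterate_lt hΩ.isOpen hΩ.isConnected.isPreconnected
    hΩ.isBounded hf hm (hAΩ hx) (half_pos hε), ?_⟩
  have h := tendsto_edist_iterate hΩ hf hm hdiv (hAΩ hx) ho
  filter_upwards [h.eventually (gt_mem_nhds (ENNReal.ofReal_pos.2 (half_pos hε)))] with n hn y hy
  rw [edist_dist, ENNReal.ofReal_lt_ofReal_iff (half_pos hε)] at hn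
  have h1 : dist (f^[n] x) (f^[n] y) < ε / 2 := hy n
  linarith [dist_triangle_left (f^[n] y) (f^[n] o) (f^[n] x)]

/-- If an orbit without cluster points in the domain has two cluster points `ξ ≠ η`, then it cannot
return to `ξ` while staying at a bounded Kobayashi distance. -/
lemma not_frequently_kobayashiDist_le (hΩ : IsGoldilocksDomain Ω) (hf : DifferentiableOn ℂ f Ω)
    (hm : MapsTo f Ω Ω) (hdiv : ∀ x ∈ Ω, ∀ y ∈ Ω, ¬ MapClusterPt y atTop fun n : ℕ => f^[n] x)
    (ho : o ∈ Ω) (hη : MapClusterPt η atTop fun n : ℕ => f^[n] o) (hne : ξ ≠ η) (R : ℝ) :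
    ¬ ∃ᶠ n in atTop ⊓ comap (fun n : ℕ => f^[n] o) (𝓝 ξ), kobayashiDist Ω (f^[n] o) o ≤ R := by
  intro hR
  have hc := hΩ.isConnected.isPreconnected
  -- Times n → ∞ along which f^n(o) → ξ. As orbits are asymptotic, `F` is stable under n ↦ n + N,
  -- which allows the descent to be repeated.
  set F := atTop ⊓ comap (fun n : ℕ => f^[n] o) (𝓝 ξ) with hF
  obtain ⟨D, hD, hdist⟩ := exists_dist_le_mul_kobayashiDist hΩ.isOpen hc hΩ.isBounded
  set ε := dist ξ η / 3 with hεdef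
  have hε : 0 < ε := div_pos (dist_pos.2 hne) three_pos
  obtain ⟨r, hr, hvis⟩ := hΩ.visibility hε
  -- Contains every point visibility can produce, and `o` to start the descent.
  set A := insert o {x | x ∈ Ω ∧ r ≤ boundaryDist Ω x} with hAdef
  have hA : IsCompact A := (isCompact_setOf_le_boundaryDist hΩ.isOpen hΩ.isBounded hr).insert o
  have hAΩ : A ⊆ Ω := insert_subset ho fun x hx => hx.1
  set c := r / (4 * D)
  have hcpos : 0 < c := by positivity
  have hsep : ∀ k ∈ Ω, r ≤ boundaryDist Ω k → ∀ z ∈ Ω, boundaryDist Ω z < r / 2 →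
      2 * c ≤ kobayashiDist Ω k z := by
    intro k hk hkr z hz hzr
    have h1 := hdist k hk z hz
    have h2 := boundaryDist_le_add_dist (Ω := Ω) k z
    have h3 : r / 2 ≤ D * kobayashiDist Ω k z := by linarith
    rw [mul_div_assoc', div_le_iff₀ (by positivity)]
    linarith
  obtain ⟨N, hNη, hNo, hNr⟩ := ((hη.frequently (ball_mem_nhds η (half_pos hε))).and_eventually
    ((eventually_forall_dist_iterate_lt_of_isCompact hΩ hf hm hdiv ho hA hAΩ (half_pos hε)).and
      (eventually_forall_boundaryDist_lt hΩ.isOpen hc hΩ.isBounded hf hm hdiv hA hAΩ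
        (half_pos hr)))).exists
  have hAη : ∀ k ∈ A, dist (f^[N] k) η < ε := fun k hk => by
    have h1 := hNo k hk
    have h2 : dist (f^[N] o) η < ε / 2 := hNη
    linarith [dist_triangle (f^[N] k) (f^[N] o) η]
  have hF1 : Tendsto (fun n : ℕ => f^[n] o) F (𝓝 ξ) := tendsto_comap.mono_left inf_le_right
  have hF2 : Tendsto (fun n : ℕ => f^[n + N] o) F (𝓝 ξ) := by
    have h := (tendsto_edist_iterate hΩ hf hm hdiv ho (hm.iterate N ho)).mono_left
      (inf_le_left : F ≤ atTop)
    have h' := (tendsto_iff_edist_tendsto_0.1 hF1).add h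
    rw [add_zero] at h'
    rw [tendsto_iff_edist_tendsto_0]
    refine tendsto_of_tendsto_of_tendsto_of_le_of_le tendsto_const_nhds h'
      (fun _ => zero_le) fun n => ?_
    simp only [Function.iterate_add_apply]
    rw [edist_comm _ ξ, edist_comm _ ξ]
    exact edist_triangle _ _ _
  have hF3 : Tendsto (fun n : ℕ => n + N) F F := by
    refine tendsto_inf.2 ⟨(tendsto_add_atTop_nat N).mono_left inf_le_left, ?_⟩
    exact tendsto_comap_iff.2 hF2
  -- After N more iterations f^(n+N)(o) is near ξ while f^N(k) is near η, so visibility gives k' in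
  -- `A` between them. As f^N(k) is close to the boundary, K(k', f^N k) ≥ 2c; with visibility error
  -- c this leaves K(f^(n+N) o, k') ≤ a - c.
  have hstep : ∀ a, (∃ᶠ n in F, ∃ k ∈ A, kobayashiDist Ω (f^[n] o) k ≤ a) →
      ∃ᶠ n in F, ∃ k ∈ A, kobayashiDist Ω (f^[n] o) k ≤ a - c := by
    intro a ha
    refine hF3.frequently ((ha.and_eventually (hF2.eventually (ball_mem_nhds ξ hε))).mono ?_)
    rintro n ⟨⟨k, hk, hka⟩, hn⟩
    have hkΩ := hAΩ hk
    have h1 := kobayashiDist_iterate_le hΩ.isOpen hc hf hm N (hm.iterate n ho) hkΩ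
    rw [← Function.iterate_add_apply, add_comm] at h1
    have hn' : dist (f^[n + N] o) ξ < ε := hn
    have h2 : ε ≤ dist (f^[n + N] o) (f^[N] k) := by
      have h3 := dist_triangle4 ξ (f^[n + N] o) (f^[N] k) η
      rw [dist_comm ξ (f^[n + N] o)] at h3
      linarith [hAη k hk, show dist ξ η = 3 * ε by rw [hεdef]; ring]
    obtain ⟨k', hk'Ω, hk'r, hk'⟩ := hvis _ (hm.iterate (n + N) ho) _ (hm.iterate N hkΩ) h2 c hcpos
    refine ⟨k', mem_insert_of_mem _ ⟨hk'Ω, hk'r⟩, ?_⟩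
    linarith [hsep k' hk'Ω hk'r _ (hm.iterate N hkΩ) (hNr k hk)]
  have hiter : ∀ j : ℕ, ∃ᶠ n in F, ∃ k ∈ A, kobayashiDist Ω (f^[n] o) k ≤ R - j * c := by
    intro j
    induction j with
    | zero => exact hR.mono fun n hn => ⟨o, mem_insert _ _, by simpa using hn⟩
    | succ j ih =>
      have h := hstep _ ih
      rwa [show R - j * c - c = R - ((j + 1 : ℕ) : ℝ) * c by push_cast; ring] at h
  obtain ⟨j, hj⟩ := exists_nat_gt (R / c)
  obtain ⟨n, k, -, hk⟩ := (hiter j).exists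
  have := kobayashiDist_nonneg (Ω := Ω) (x := f^[n] o) (y := k)
  rw [div_lt_iff₀ hcpos] at hj
  linarith

/-- Times with K(f^n o, o) bounded would accumulate at some z; one of ξ, η differs from z, and the
descent applies to that pair. -/
lemma tendsto_kobayashiDist_iterate_atTop (hΩ : IsGoldilocksDomain Ω)
    (hf : DifferentiableOn ℂ f Ω) (hm : MapsTo f Ω Ω)
    (hdiv : ∀ x ∈ Ω, ∀ y ∈ Ω, ¬ MapClusterPt y atTop fun n : ℕ => f^[n] x)
    (ho : o ∈ Ω) (hξ : MapClusterPt ξ atTop fun n : ℕ => f^[n] o)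
    (hη : MapClusterPt η atTop fun n : ℕ => f^[n] o) (hne : ξ ≠ η) :
    Tendsto (fun n : ℕ => kobayashiDist Ω (f^[n] o) o) atTop atTop := by
  rw [Filter.tendsto_atTop]
  intro R
  by_contra hcon
  set S := {n : ℕ | kobayashiDist Ω (f^[n] o) o ≤ R}
  have hS : ∃ᶠ n in atTop, n ∈ S := by
    rw [not_eventually] at hcon
    exact hcon.mono fun n hn => (not_le.1 hn).le
  have : NeBot (atTop ⊓ 𝓟 S) := frequently_mem_iff_neBot.1 hS
  obtain ⟨z, -, hz⟩ := hΩ.isBounded.isCompact_closure.exists_mapClusterPt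
    (f := atTop ⊓ 𝓟 S) (u := fun n : ℕ => f^[n] o)
    (tendsto_principal.2 (Eventually.of_forall fun n => subset_closure (hm.iterate n ho)))
  have hfreq : ∃ᶠ n in atTop ⊓ comap (fun n : ℕ => f^[n] o) (𝓝 z), n ∈ S := by
    rw [frequently_mem_iff_neBot, inf_right_comm, neBot_inf_comap_iff_map, inf_comm]
    exact hz
  rcases eq_or_ne z η with rfl | hzη
  · exact not_frequently_kobayashiDist_le hΩ hf hm hdiv ho hξ hne.symm R hfreq
  · exact not_frequently_kobayashiDist_le hΩ hf hm hdiv ho hη hzη R hfreq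

/-- An orbit without cluster points in the domain has at most one cluster point. -/
lemma mapClusterPt_iterate_unique (hΩ : IsGoldilocksDomain Ω)
    (hf : DifferentiableOn ℂ f Ω) (hm : MapsTo f Ω Ω)
    (hdiv : ∀ x ∈ Ω, ∀ y ∈ Ω, ¬ MapClusterPt y atTop fun n : ℕ => f^[n] x)
    (ho : o ∈ Ω) (hξ : MapClusterPt ξ atTop fun n : ℕ => f^[n] o)
    (hη : MapClusterPt η atTop fun n : ℕ => f^[n] o) : ξ = η := by
  by_contra hne
  have hc := hΩ.isConnected.isPreconnected
  have hinf := tendsto_kobayashiDist_iterate_atTop hΩ hf hm hdiv ho hξ hη hne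
  -- Record times of K(f^n o, o). With z a limit along records and w another cluster point, an m
  -- near w is fixed first, then a record n > m near z.
  set S := {n : ℕ | ∀ k < n, kobayashiDist Ω (f^[k] o) o < kobayashiDist Ω (f^[n] o) o}
  have hS : ∃ᶠ n in atTop, n ∈ S := frequently_high_scores hinf
  have : NeBot (atTop ⊓ 𝓟 S) := frequently_mem_iff_neBot.1 hS
  obtain ⟨z, -, hz⟩ := hΩ.isBounded.isCompact_closure.exists_mapClusterPt
    (f := atTop ⊓ 𝓟 S) (u := fun n : ℕ => f^[n] o)
    (tendsto_principal.2 (Eventually.of_forall fun n => subset_closure (hm.iterate n ho)))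
  obtain ⟨w, hw, hwz⟩ : ∃ w, (MapClusterPt w atTop fun n : ℕ => f^[n] o) ∧ z ≠ w := by
    rcases eq_or_ne z η with rfl | h
    · exact ⟨ξ, hξ, Ne.symm hne⟩
    · exact ⟨η, hη, h⟩
  set ε := dist z w / 3 with hεdef
  have hε : 0 < ε := div_pos (dist_pos.2 hwz) three_pos
  obtain ⟨r, hr, hvis⟩ := hΩ.visibility hε
  obtain ⟨C, -, α, hα, hK⟩ := hΩ.dist_growth o ho
  set R := C + α * Real.log (1 / r)
  have hR : ∀ k ∈ Ω, r ≤ boundaryDist Ω k → kobayashiDist Ω o k ≤ R := fun k hk hkr => by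
    refine (hK k hk).trans (show _ ≤ C + α * Real.log (1 / r) from ?_)
    have := hr.trans_le hkr
    gcongr
  obtain ⟨m, hmw, hmR⟩ := ((hw.frequently (ball_mem_nhds w hε)).and_eventually
    (hinf.eventually_gt_atTop (2 * R + 1))).exists
  have hmw' : dist (f^[m] o) w < ε := hmw
  obtain ⟨n, hnz, hmn, hnS⟩ := ((hz.frequently (ball_mem_nhds z hε)).and_eventually
    (((eventually_gt_atTop m).filter_mono inf_le_left).and
      (mem_inf_of_right (mem_principal_self S)))).exists
  have hnz' : dist (f^[n] o) z < ε := hnz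
  have hfar : ε ≤ dist (f^[n] o) (f^[m] o) := by
    have h3 := dist_triangle4 z (f^[n] o) (f^[m] o) w
    rw [dist_comm z (f^[n] o)] at h3
    linarith [show dist z w = 3 * ε by rw [hεdef]; ring]
  obtain ⟨k, hk, hkr, hkn⟩ := hvis _ (hm.iterate n ho) _ (hm.iterate m ho) hfar 1 one_pos
  -- K(f^n o, f^m o) ≤ K(f^(n-m) o, o) ≤ K(f^n o, o), as n is a record. Passing through the visible
  -- point k, with K(o, k) ≤ R, this forces K(f^m o, o) ≤ 2R + 1, against the choice of m.
  have h1 : kobayashiDist Ω (f^[n] o) (f^[m] o) ≤ kobayashiDist Ω (f^[n] o) o := by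
    have h := kobayashiDist_iterate_le hΩ.isOpen hc hf hm m (hm.iterate (n - m) ho) ho
    rw [← Function.iterate_add_apply, Nat.add_sub_cancel' hmn.le] at h
    rcases Nat.eq_zero_or_pos m with rfl | hm0
    · simp
    · exact h.trans (hnS (n - m) (by omega)).le
  have h2 := kobayashiDist_triangle hΩ.isOpen hc (hm.iterate n ho) hk ho
  have h3 := kobayashiDist_triangle hΩ.isOpen hc (hm.iterate m ho) hk ho
  have h4 := hR k hk hkr
  rw [kobayashiDist_comm k o] at h2 h3
  rw [kobayashiDist_comm _ k] at h3
  linarith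

end Divergence

theorem theorem1p4 {d : ℕ} (Ω : Set (EuclideanSpace ℂ (Fin d)))
    (hΩ : IsGoldilocksDomain Ω) (htaut : IsTaut Ω)
    (f : EuclideanSpace ℂ (Fin d) → EuclideanSpace ℂ (Fin d))
    (hf : DifferentiableOn ℂ f Ω) (hmaps : MapsTo f Ω Ω) :
    (∀ x ∈ Ω, IsCompact (closure (range fun n : ℕ => f^[n] x)) ∧
        closure (range fun n : ℕ => f^[n] x) ⊆ Ω) ∨
      (∃ ξ ∈ frontier Ω,
        (∀ x ∈ Ω, Tendsto (fun n : ℕ => f^[n] x) atTop (𝓝 ξ)) ∧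
        ∀ A : Set (EuclideanSpace ℂ (Fin d)), IsCompact A → A ⊆ Ω →
          TendstoUniformlyOn (fun n : ℕ => f^[n]) (fun _ => ξ) atTop A) := by
  by_cases hdiv : ∀ x ∈ Ω, ∀ y ∈ Ω, ¬ MapClusterPt y atTop fun n : ℕ => f^[n] x
  swap
  · push Not at hdiv
    obtain ⟨o, ho, y, hy, hoy⟩ := hdiv
    exact Or.inl fun x hx => hΩ.isCompact_closure_orbit htaut hf hmaps ho hy hoy hx
  right
  obtain ⟨o, ho⟩ := hΩ.isConnected.nonempty
  have hmem : ∀ n, f^[n] o ∈ closure Ω := fun n => subset_closure (hmaps.iterate n ho)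
  obtain ⟨ξ, hξ, hcl⟩ := hΩ.isBounded.isCompact_closure.exists_mapClusterPt
    (f := atTop) (u := fun n : ℕ => f^[n] o)
    (tendsto_principal.2 (Eventually.of_forall hmem))
  have hlim : Tendsto (fun n : ℕ => f^[n] o) atTop (𝓝 ξ) :=
    hΩ.isBounded.isCompact_closure.le_nhds_of_unique_clusterPt
      (mem_map.2 (Eventually.of_forall hmem))
      fun z _ hz => mapClusterPt_iterate_unique hΩ hf hmaps hdiv ho hz hcl
  have hunif : ∀ A : Set (EuclideanSpace ℂ (Fin d)), IsCompact A → A ⊆ Ω →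
      TendstoUniformlyOn (fun n : ℕ => f^[n]) (fun _ => ξ) atTop A := by
    intro A hA hAΩ
    rw [Metric.tendstoUniformlyOn_iff]
    intro ε hε
    filter_upwards [eventually_forall_dist_iterate_lt_of_isCompact hΩ hf hmaps hdiv ho hA hAΩ
      (half_pos hε), hlim.eventually (ball_mem_nhds ξ (half_pos hε))] with n h1 h2 x hx
    have h3 : dist (f^[n] o) ξ < ε / 2 := h2
    rw [dist_comm]
    linarith [h1 x hx, dist_triangle (f^[n] x) (f^[n] o) ξ]
  refine ⟨ξ, ?_, fun x hx => ?_, hunif⟩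
  · rw [hΩ.isOpen.frontier_eq]
    exact ⟨hξ, fun h => hdiv o ho ξ h hcl⟩
  · exact (hunif {x} isCompact_singleton (by simpa using hx)).tendsto_at (mem_singleton x)
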